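/- For $n\in\mathbb N=\{1,2,\dots\}$ let $\mathrm B_{n,\frac12}$ be the symmetric binomial law on $\mathbb R$, with $\mathrm B_{n,\frac12}(\{k\})=\mathrm b_{n,\frac12}(k):=\binom nk 2^{-n}$ for $k\in\{0,\dots,n\}$, let $\widetilde{\mathrm B_{n,\frac12}}$ be its standardization (its image under $x\mapsto (x-\mu)/\sigma$ with $\mu$ its mean and $\sigma$ its standard deviation), and let $\mathrm N$ be the standard normal law. For probability measures $P,Q$ on $\mathbb R$ write $Pf=\int f\,\mathrm dP$ and let $\zeta_3(P,Q):=\sup_f |Pf-Qf|\in[0,\infty]$ be the Zolotarev distance of order $3$, the supremum being taken over all bounded twice continuously differentiable $f:\mathbb R\to\mathbb R$ with $|f''(x)-f''(y)|\le |x-y|$ for all $x,y\in\mathbb R$. Put $$\varepsilon_n:=\zeta_3\big(\widetilde{\mathrm B_{n,\frac12}},\mathrm N\big),\qquad L_n:=\frac16\begin{cases}\Big|\big(2n^{1/2}+n^{-1/2}-n^{-3/2}\big)\,\mathrm b_{n,\frac12}\big(\lfloor\tfrac n2\rfloor\big)-\frac4{\sqrt{2\pi}}\Big| & \text{if } n \text{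 is odd},\\[1ex] \Big|2n^{1/2}\,\mathrm b_{n,\frac12}\big(\tfrac n2\big)-\frac4{\sqrt{2\pi}}\Big| & \text{if } n\text{ is even}.\end{cases}$$ Then $L_n=\dfrac1{6\sqrt{2\pi}\,n}+O(n^{-2})$ as $n\to\infty$, and for every $n\in\mathbb N$ $$L_n=\Big|\big(\widetilde{\mathrm B_{n,\frac12}}-\mathrm N\big)\tfrac{|\cdot|^3}{6}\Big|\le\varepsilon_n<\frac1{3\sqrt{2\pi}\,n}+\Big(\frac{4+\zeta(\frac12)}{\sqrt{2\pi}}-1\Big)\frac1{6n^{3/2}}<\frac{0.1330}{n}+\frac{0.0022}{n^{3/2}}\le\frac{0.1352}{n},$$ where $\zeta(\cdot)$ is the Riemann zeta function; in particular $\zeta(\frac12)=-1.4603\ldots$ is real, with $-1.4604<\zeta(\frac12)\le-1.4603$. -/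

import Mathlib

open MeasureTheory ProbabilityTheory Filter Asymptotics
open scoped ENNReal

noncomputable section

/-- The class `𝓕_s` for `s > 0`: with `m = ⌈s - 1⌉` and `α = s - m ∈ (0, 1]`, the `m` times
continuously differentiable `f : ℝ → ℝ` whose `m`-th derivative has `α`-Hölder constant at
most `1`. -/
def ZolotarevClass (s : ℝ) : Set (ℝ → ℝ) :=
  {f | ContDiff ℝ (⌈s - 1⌉₊ : ℕ) f ∧
    ∀ x y : ℝ, |iteratedDeriv ⌈s - 1⌉₊ f x - iteratedDeriv ⌈s - 1⌉₊ f y|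
      ≤ |x - y| ^ (s - (⌈s - 1⌉₊ : ℝ))}

/-- The class `𝓕_s^∞` of the bounded functions in `𝓕_s`. -/
def BoundedZolotarevClass (s : ℝ) : Set (ℝ → ℝ) :=
  {f | f ∈ ZolotarevClass s ∧ ∃ C : ℝ, ∀ x : ℝ, |f x| ≤ C}

/-- The Zolotarev distance `ζ_s(P, Q) = sup {|∫ f dP - ∫ f dQ| : f ∈ 𝓕_s^∞}` of order `s > 0`
between two probability measures on `ℝ`, with values in `[0, ∞]`. -/
def zolotarevDist (s : ℝ) (P Q : Measure ℝ) : ℝ≥0∞ :=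
  ⨆ f ∈ BoundedZolotarevClass s, ENNReal.ofReal |∫ x, f x ∂P - ∫ x, f x ∂Q|

/-- The standardization of a law `P` on `ℝ` with finite positive variance: its image under
`x ↦ (x - μ(P)) / σ(P)`. -/
def standardization (P : Measure ℝ) : Measure ℝ :=
  P.map fun x => (x - ∫ y, y ∂P) / √(variance (fun y : ℝ => y) P)

/-- The symmetric binomial law `B_{n,1/2}`, as a measure on `ℝ`. -/
def symBinomial (n : ℕ) : Measure ℝ :=
  (binomial n ⟨1 / 2, by norm_num, by norm_num⟩).map (Nat.cast : ℕ → ℝ)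

/-- The symmetric binomial probability `b_{n,1/2}(k)`. -/
def symBinomialMass (n k : ℕ) : ℝ := (n.choose k : ℝ) / 2 ^ n

/-- `ε_n`, the Zolotarev distance of order `3` between the standardized symmetric binomial law
and the standard normal law. -/
def binomialNormalDist (n : ℕ) : ℝ≥0∞ :=
  zolotarevDist 3 (standardization (symBinomial n)) (gaussianReal 0 1)

/-- The explicit lower bound for `ε_n`. -/
def binomialNormalLower (n : ℕ) : ℝ :=
  1 / 6 * if Odd n then
      |(2 * (n : ℝ) ^ (1 / 2 : ℝ) + (n : ℝ) ^ (-1 / 2 : ℝ) - (n : ℝ) ^ (-3 / 2 : ℝ))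
          * symBinomialMass n (n / 2) - 4 / √(2 * Real.pi)|
    else
      |2 * (n : ℝ) ^ (1 / 2 : ℝ) * symBinomialMass n (n / 2) - 4 / √(2 * Real.pi)|

/-- The explicit upper bound for `ε_n`. -/
def binomialNormalUpper (n : ℕ) : ℝ :=
  1 / (3 * √(2 * Real.pi) * n)
    + ((4 + (riemannZeta (1 / 2)).re) / √(2 * Real.pi) - 1) * (1 / (6 * (n : ℝ) ^ (3 / 2 : ℝ)))

end

/-! Upper bound: write the binomial law as the law of a simple symmetric random walk and replace its
`±1` steps by standard normal ones, one at a time (Lindeberg). Each replacement rests on one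
inequality: if `d` is even and `d''` increases on `[0, ∞)`, then a quadratic touching `d` at `±1`
lies below `d` (`quadratic_minorant`). Since `±1` and the standard normal share their first two
moments, integration gives `d 1 ≤ E d(Z)`. Applied to `H ± s`, with `s` the symmetrization of the
test function about a point and `H` an explicit even function whose second derivative outgrows
`s''`, this bounds the error by `E H(Z) - H 1`.

Without smoothing, `H = |t|³/6` is forced by the Lipschitz condition on `f''`, and the error is
`(4/√(2π) - 1)/6`. After `k ≥ 1` steps are already normal, the test function is smoothed by `N(0,
k)`. Its third derivative is then Lipschitz with constant `2/√(2πk)`, so `H` may be a multiple of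
`t⁴` and the error drops to `1/(6√(2πk))`. The errors add up to the unsmoothed one plus a multiple
of `∑_{k<n} k^(-1/2)`, which is strictly below `2√n + ζ(1/2)` because the differences increase to
`ζ(1/2)`. Rescaling from the walk to its standardization divides by `n^(3/2)` and yields exactly the
stated upper bound.

Lower bound: `|x|³/6` is unbounded, hence not admissible, but it is a dominated limit of rescaled
admissible functions. Its binomial moment telescopes to a multiple of the central binomial
probability, and Wallis' product gives two-sided bounds on that probability, sharp enough for the
`O(n⁻²)` expansion. The numerical value of `ζ(1/2)` comes from Euler–Maclaurin corrections that make
the partial sums monotone from either side. -/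

/-! ### `ζ(1/2)` as a limit of partial sums -/

/-- The `n`-th term, starting from `n = 0`, of a series for `(s - 1) ζ(s) - 1` on `0 < re s`. -/
noncomputable def zetaTerm (n : ℕ) (s : ℂ) : ℂ :=
  (s - 1) * ((n + 1 : ℝ) : ℂ) ^ (-s) + ((n + 1 + 1 : ℝ) : ℂ) ^ (1 - s) - ((n + 1 : ℝ) : ℂ) ^ (1 - s)

lemma hasDerivAt_ofReal_cpow (c : ℂ) {x : ℝ} (hx : 0 < x) :
    HasDerivAt (fun y : ℝ => (y : ℂ) ^ c) (c * (x : ℂ) ^ (c - 1)) x := by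
  have h := (hasDerivAt_id (x : ℂ)).cpow_const (c := c) (Or.inl (by simpa using hx))
  simpa using h.comp_ofReal

lemma norm_ofReal_cpow_sub_le {s : ℂ} (hs : 1 / 4 < s.re) {a x : ℝ} (ha : 1 ≤ a)
    (hx : x ∈ Set.Icc a (a + 1)) :
    ‖(x : ℂ) ^ (-s) - (a : ℂ) ^ (-s)‖ ≤ ‖s‖ * a ^ (-(5 / 4) : ℝ) := by
  have key := norm_image_sub_le_of_norm_deriv_le_segment' (a := a) (b := a + 1)
    (f := fun y : ℝ => (y : ℂ) ^ (-s)) (f' := fun y : ℝ => -s * (y : ℂ) ^ (-s - 1))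
    (C := ‖s‖ * a ^ (-(5 / 4) : ℝ))
    (fun y hy => (hasDerivAt_ofReal_cpow _ (by linarith [hy.1])).hasDerivWithinAt)
    (fun y hy => by
      have hy0 : 0 < y := by linarith [hy.1]
      rw [norm_mul, norm_neg, Complex.norm_cpow_eq_rpow_re_of_pos hy0]
      gcongr
      calc y ^ (-s - 1).re ≤ a ^ (-s - 1).re :=
            Real.rpow_le_rpow_of_nonpos (by linarith) hy.1 (by simp; linarith)
        _ ≤ a ^ (-(5 / 4) : ℝ) := Real.rpow_le_rpow_of_exponent_le ha (by simp; linarith)) x hx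
  refine key.trans ?_
  have : 0 ≤ ‖s‖ * a ^ (-(5 / 4) : ℝ) := by positivity
  nlinarith [hx.2]

/-- The term is `1 - s` times the integral over `[a, a + 1]`, `a = n + 1`, of `y^(-s) - a^(-s)`, so
a second use of the mean value inequality gains one power of `a`. The fixed exponent `5/4` makes the
bound uniform on `re s > 1/4` once `s` is bounded. -/
lemma norm_zetaTerm_le {s : ℂ} (hs : 1 / 4 < s.re) (n : ℕ) :
    ‖zetaTerm n s‖ ≤ ‖s - 1‖ * ‖s‖ * (n + 1 : ℝ) ^ (-(5 / 4) : ℝ) := by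
  set a : ℝ := n + 1 with ha
  have ha1 : 1 ≤ a := by simp [ha]
  have key := norm_image_sub_le_of_norm_deriv_le_segment' (a := a) (b := a + 1)
    (f := fun y : ℝ => (s - 1) * ((a : ℂ) ^ (-s) * y) + (y : ℂ) ^ (1 - s))
    (f' := fun y : ℝ => (s - 1) * ((a : ℂ) ^ (-s) * 1) + (1 - s) * (y : ℂ) ^ (1 - s - 1))
    (C := ‖s - 1‖ * (‖s‖ * a ^ (-(5 / 4) : ℝ)))
    (fun y hy => ((((hasDerivAt_id (y : ℂ)).comp_ofReal.const_mul _).const_mul _).add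
      (hasDerivAt_ofReal_cpow _ (by linarith [hy.1]))).hasDerivWithinAt)
    (fun y hy => by
      have : (s - 1) * ((a : ℂ) ^ (-s) * 1) + (1 - s) * (y : ℂ) ^ (1 - s - 1)
          = (1 - s) * ((y : ℂ) ^ (-s) - (a : ℂ) ^ (-s)) := by
        rw [show 1 - s - 1 = -s by ring]; ring
      rw [this, norm_mul, norm_sub_rev 1 s]
      gcongr
      exact norm_ofReal_cpow_sub_le hs ha1 (Set.Ico_subset_Icc_self hy)) (a + 1)
    (by simp)
  rw [zetaTerm, ← ha]
  refine le_of_eq_of_le ?_ (key.trans_eq (by ring))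
  congr 1
  push_cast
  ring

lemma differentiable_zetaTerm (n : ℕ) : Differentiable ℂ (zetaTerm n) := by
  have h1 : ((n + 1 : ℝ) : ℂ) ≠ 0 := by
    rw [Complex.ofReal_ne_zero]; positivity
  have h2 : ((n + 1 + 1 : ℝ) : ℂ) ≠ 0 := by
    rw [Complex.ofReal_ne_zero]; positivity
  unfold zetaTerm
  intro s
  refine DifferentiableAt.sub (DifferentiableAt.add (DifferentiableAt.mul (by fun_prop) ?_) ?_) ?_ <;>
  exact DifferentiableAt.const_cpow (by fun_prop) (Or.inl (by assumption))

lemma sum_zetaTerm (N : ℕ) (s : ℂ) :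
    ∑ n ∈ Finset.range N, zetaTerm n s
      = (s - 1) * ∑ n ∈ Finset.range N, ((n + 1 : ℝ) : ℂ) ^ (-s) + ((N + 1 : ℝ) : ℂ) ^ (1 - s) - 1 := by
  induction N with
  | zero => simp
  | succ N ih =>
    rw [Finset.sum_range_succ, ih, Finset.sum_range_succ, zetaTerm]
    push_cast
    ring

/-- The constant 20 comes from `‖s - 1‖ * ‖s‖ ≤ 5 * 4` on the ball of radius 4, which contains both
`1/2` and `2`. -/
lemma summable_zetaTerm_bound : Summable fun n : ℕ => (20 : ℝ) * (n + 1 : ℝ) ^ (-(5 / 4) : ℝ) := by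
  refine Summable.mul_left _ ?_
  have := (summable_nat_add_iff 1).2 (Real.summable_nat_rpow.2 (by norm_num : (-(5 / 4) : ℝ) < -1))
  simpa using this

lemma hasSum_zetaTerm_of_one_lt {s : ℂ} (hs : 1 < s.re) (h4 : ‖s‖ < 4) :
    HasSum (fun n => zetaTerm n s) (riemannZeta₁ s - 1) := by
  have hs1 : s ≠ 1 := by rintro rfl; simp at hs
  have hsum : Summable fun n => zetaTerm n s := by
    refine Summable.of_norm_bounded summable_zetaTerm_bound fun n => ?_
    refine (norm_zetaTerm_le (by linarith) n).trans ?_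
    gcongr
    have : ‖s - 1‖ ≤ 5 := (norm_sub_le _ _).trans (by simp; linarith)
    nlinarith [norm_nonneg s, norm_nonneg (s - 1)]
  have h1 := hsum.hasSum.tendsto_sum_nat
  have hz : Summable fun n : ℕ => ((n + 1 : ℝ) : ℂ) ^ (-s) := by
    have := (summable_nat_add_iff 1).2 (Complex.summable_one_div_nat_cpow.2 hs)
    refine this.congr fun n => ?_
    rw [Complex.cpow_neg, one_div]; push_cast; rfl
  have hz2 : HasSum (fun n : ℕ => ((n + 1 : ℝ) : ℂ) ^ (-s)) (riemannZeta s) := by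
    rw [zeta_eq_tsum_one_div_nat_add_one_cpow hs]
    convert hz.hasSum using 3 with n
    rw [Complex.cpow_neg, one_div]; push_cast; rfl
  have h3 : Tendsto (fun N : ℕ => ((N + 1 : ℝ) : ℂ) ^ (1 - s)) atTop (nhds 0) := by
    rw [tendsto_zero_iff_norm_tendsto_zero]
    have : Tendsto (fun N : ℕ => (N + 1 : ℝ)) atTop atTop :=
      tendsto_atTop_add_const_right _ _ tendsto_natCast_atTop_atTop
    refine ((tendsto_rpow_neg_atTop (y := s.re - 1) (by linarith)).comp this).congr fun N => ?_
    rw [Complex.norm_cpow_eq_rpow_re_of_pos (by positivity)]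
    simp
  have h4 := (((hz2.tendsto_sum_nat.const_mul (s - 1)).add h3).sub_const 1).congr
    fun N => (sum_zetaTerm N s).symm
  have h5 := tendsto_nhds_unique h1 h4
  rw [riemannZeta_eq_inv_sub_mul hs1] at h5
  have h6 : s - 1 ≠ 0 := sub_ne_zero.2 hs1
  rw [mul_inv_cancel_left₀ h6, add_zero] at h5
  rw [← h5]
  exact hsum.hasSum

/-- The series is analytic on the convex set `U` and agrees with `riemannZeta₁ - 1` near `2`, hence
also at `1/2` by the identity theorem; its telescoped partial sums there are the sums in question up
to an affine map. -/
lemma tendsto_sum_rpow_sub_zeta_half :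
    Tendsto (fun N : ℕ => ∑ n ∈ Finset.range N, 1 / √(n + 1 : ℝ) - 2 * √(N + 1 : ℝ)) atTop
      (nhds (riemannZeta (1 / 2)).re) := by
  set U : Set ℂ := {s | 1 / 4 < s.re} ∩ Metric.ball 0 4 with hU
  have hUo : IsOpen U := (isOpen_lt continuous_const Complex.continuous_re).inter Metric.isOpen_ball
  have hUc : Convex ℝ U := (convex_halfSpace_re_gt _).inter (convex_ball _ _)
  have hle : ∀ (n : ℕ) (s : ℂ), s ∈ U → ‖zetaTerm n s‖ ≤ 20 * (n + 1 : ℝ) ^ (-(5 / 4) : ℝ) := by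
    intro n s hs
    refine (norm_zetaTerm_le hs.1 n).trans ?_
    gcongr
    have h4 : ‖s‖ < 4 := by simpa using hs.2
    have : ‖s - 1‖ ≤ 5 := (norm_sub_le _ _).trans (by simp; linarith)
    nlinarith [norm_nonneg s, norm_nonneg (s - 1)]
  have hd : DifferentiableOn ℂ (fun s => ∑' n, zetaTerm n s) U :=
    Complex.differentiableOn_tsum_of_summable_norm summable_zetaTerm_bound
      (fun n => (differentiable_zetaTerm n).differentiableOn) hUo hle
  have h2 : (2 : ℂ) ∈ U := ⟨by norm_num, by simp; norm_num⟩
  have heq := (hd.analyticOnNhd hUo).eqOn_of_preconnected_of_eventuallyEq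
    ((differentiable_riemannZeta₁.sub_const 1).differentiableOn.analyticOnNhd hUo)
    hUc.isPreconnected h2 (by
      have : {s : ℂ | 1 < s.re} ∩ Metric.ball 0 4 ∈ nhds (2 : ℂ) :=
        ((isOpen_lt continuous_const Complex.continuous_re).inter Metric.isOpen_ball).mem_nhds
          ⟨by norm_num, by simp; norm_num⟩
      filter_upwards [this] with s hs
      exact (hasSum_zetaTerm_of_one_lt hs.1 (by simpa using hs.2)).tsum_eq)
  have hhalf : (1 / 2 : ℂ) ∈ U := ⟨by norm_num, by simp; norm_num⟩
  have hs : HasSum (fun n => zetaTerm n (1 / 2)) (riemannZeta₁ (1 / 2) - 1) := by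
    have := heq hhalf
    simp only at this
    rw [← this]
    exact (Summable.of_norm_bounded summable_zetaTerm_bound fun n => hle n _ hhalf).hasSum
  have ht := hs.tendsto_sum_nat
  have hz : riemannZeta (1 / 2) = -2 * ((riemannZeta₁ (1 / 2) - 1) + 1) := by
    rw [riemannZeta_eq_inv_sub_mul (by norm_num)]; norm_num
  have ht2 := (Complex.continuous_re.tendsto _).comp ((ht.add_const 1).const_mul (-2))
  rw [← hz] at ht2
  refine ht2.congr fun N => ?_
  have hc : ∀ x : ℝ, 0 ≤ x → (x : ℂ) ^ (1 / 2 : ℂ) = ((√x : ℝ) : ℂ) := by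
    intro x hx
    rw [Real.sqrt_eq_rpow, Complex.ofReal_cpow hx]; norm_num
  have h1 : ∀ n : ℕ, ((n + 1 : ℝ) : ℂ) ^ (-(1 / 2) : ℂ) = ((1 / √(n + 1 : ℝ) : ℝ) : ℂ) := by
    intro n
    rw [Complex.cpow_neg, hc _ (by positivity)]; push_cast; rw [one_div]
  simp only [Function.comp, sum_zetaTerm, h1]
  rw [show (1 - 1 / 2 : ℂ) = 1 / 2 by norm_num, hc _ (by positivity), ← Complex.ofReal_sum]
  have : (-2 : ℂ) * ((1 / 2 - 1) * ((∑ n ∈ Finset.range N, 1 / √(n + 1 : ℝ) : ℝ) : ℂ)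
      + ((√(N + 1 : ℝ) : ℝ) : ℂ) - 1 + 1)
      = ((∑ n ∈ Finset.range N, 1 / √(n + 1 : ℝ) - 2 * √(N + 1 : ℝ) : ℝ) : ℂ) := by
    push_cast; ring
  rw [this, Complex.ofReal_re]

lemma riemannZeta_half_im : (riemannZeta (1 / 2)).im = 0 := by
  have h := riemannZeta_conj (1 / 2)
  rw [map_div₀, map_one, map_ofNat] at h
  exact Complex.conj_eq_iff_im.1 h.symm

/-- The differences increase strictly, by `2 * (√(x + 1) - √x) < 1 / √x`, so each lies strictly
below the limit. -/
lemma sum_one_div_sqrt_lt (N : ℕ) :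
    ∑ n ∈ Finset.range N, 1 / √(n + 1 : ℝ) < 2 * √(N + 1 : ℝ) + (riemannZeta (1 / 2)).re := by
  set A : ℕ → ℝ := fun N => ∑ n ∈ Finset.range N, 1 / √(n + 1 : ℝ) - 2 * √(N + 1 : ℝ) with hA
  have hmono : StrictMono A := by
    refine strictMono_nat_of_lt_succ fun n => ?_
    simp only [hA, Finset.sum_range_succ]
    push_cast
    have hx : 0 < √(n + 1 : ℝ) := Real.sqrt_pos.2 (by positivity)
    have hx2 : √(n + 1 : ℝ) ^ 2 = n + 1 := Real.sq_sqrt (by positivity)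
    have hy2 : √(n + 1 + 1 : ℝ) ^ 2 = n + 1 + 1 := Real.sq_sqrt (by positivity)
    have hy : √(n + 1 : ℝ) < √(n + 1 + 1 : ℝ) := Real.sqrt_lt_sqrt (by positivity) (by linarith)
    have : 2 * (√(n + 1 + 1 : ℝ) - √(n + 1 : ℝ)) < 1 / √(n + 1 : ℝ) := by
      rw [lt_div_iff₀ hx]; nlinarith
    linarith
  have h1 : A N < A (N + 1) := hmono (Nat.lt_succ_self N)
  have h2 : A (N + 1) ≤ (riemannZeta (1 / 2)).re :=
    hmono.monotone.ge_of_tendsto tendsto_sum_rpow_sub_zeta_half (N + 1)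
  simp only [hA] at h1 h2
  linarith

/-! ### Numerical enclosure of `ζ(1/2)` -/

/-- Corrected partial sums of `∑ k ^ (-1/2)`; they converge to `ζ(1/2)`. -/
noncomputable def zetaHalfApprox (c : ℝ) (N : ℕ) : ℝ :=
  ∑ n ∈ Finset.range N, 1 / √(n + 1 : ℝ) - 2 * √(N + 1 : ℝ) + 1 / (2 * √(N + 1 : ℝ))
    + c / √(N + 1 : ℝ) ^ 3

lemma tendsto_zetaHalfApprox (c : ℝ) :
    Tendsto (zetaHalfApprox c) atTop (nhds (riemannZeta (1 / 2)).re) := by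
  have h1 : Tendsto (fun N : ℕ => √(N + 1 : ℝ)) atTop atTop :=
    Real.tendsto_sqrt_atTop.comp (tendsto_atTop_add_const_right _ _ tendsto_natCast_atTop_atTop)
  have h2 : Tendsto (fun N : ℕ => 1 / (2 * √(N + 1 : ℝ))) atTop (nhds 0) :=
    (h1.const_mul_atTop (by norm_num : (0 : ℝ) < 2)).const_div_atTop 1
  have h3 : Tendsto (fun N : ℕ => c / √(N + 1 : ℝ) ^ 3) atTop (nhds 0) :=
    ((tendsto_pow_atTop (by norm_num : (3 : ℕ) ≠ 0)).comp h1).const_div_atTop c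
  have h := (tendsto_sum_rpow_sub_zeta_half.add h2).add h3
  rwa [add_zero, add_zero] at h

/-- Multiplying by suitable powers of `(y - x) * (x + y) = 1` extracts the factor `(y - x)³` from
every term. The sign of an increment is then that of an explicit polynomial. -/
lemma zetaHalfApprox_step_aux (c : ℝ) {x y : ℝ} (hx : 0 < x) (hy : 0 < y) (h : y ^ 2 = x ^ 2 + 1) :
    (1 / x - 2 * y + 1 / (2 * y) + c / y ^ 3) - (-2 * x + 1 / (2 * x) + c / x ^ 3)
      = ((x * y) ^ 2 / 2 - c * ((x ^ 2 + x * y + y ^ 2) * (x + y) ^ 2))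
        * ((y - x) ^ 3 / (x * y) ^ 3) := by
  have h1 : (y - x) * (x + y) = 1 := by linear_combination h
  have e1 : (1 / x - 2 * y + 1 / (2 * y) + c / y ^ 3) - (-2 * x + 1 / (2 * x) + c / x ^ 3)
      = ((x * y) ^ 2 * ((x + y) - 4 * (x * y) * (y - x)) / 2
        - c * ((y - x) * (x ^ 2 + x * y + y ^ 2))) / (x * y) ^ 3 := by
    field_simp
    ring
  have e2 : (x + y) - 4 * (x * y) * (y - x) = (y - x) ^ 3 := by
    linear_combination (-(x + y)) * h1
  have e3 : (y - x) * (x ^ 2 + x * y + y ^ 2)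
      = (x ^ 2 + x * y + y ^ 2) * (x + y) ^ 2 * (y - x) ^ 3 := by
    linear_combination (-(y - x) * (x ^ 2 + x * y + y ^ 2) * ((y - x) * (x + y) + 1)) * h1
  rw [e1, e2, e3]
  ring

lemma zetaHalfApprox_succ_sub (c : ℝ) (N : ℕ) :
    zetaHalfApprox c (N + 1) - zetaHalfApprox c N
      = ((√(N + 1 : ℝ) * √(N + 1 + 1 : ℝ)) ^ 2 / 2 - c * ((√(N + 1 : ℝ) ^ 2
          + √(N + 1 : ℝ) * √(N + 1 + 1 : ℝ) + √(N + 1 + 1 : ℝ) ^ 2)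
            * (√(N + 1 : ℝ) + √(N + 1 + 1 : ℝ)) ^ 2))
        * ((√(N + 1 + 1 : ℝ) - √(N + 1 : ℝ)) ^ 3 / (√(N + 1 : ℝ) * √(N + 1 + 1 : ℝ)) ^ 3) := by
  rw [← zetaHalfApprox_step_aux c (Real.sqrt_pos.2 (by positivity)) (Real.sqrt_pos.2 (by positivity))
    (by rw [Real.sq_sqrt (by positivity), Real.sq_sqrt (by positivity)])]
  simp only [zetaHalfApprox, Finset.sum_range_succ]
  push_cast
  ring

/-- With the Euler–Maclaurin coefficient `1/24` the approximations decrease: by AM–GM the factor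
multiplying `c` is at least `3xy * 4xy = 12 (xy)²`. -/
lemma zeta_half_le_approx (N : ℕ) : (riemannZeta (1 / 2)).re ≤ zetaHalfApprox (1 / 24) N := by
  refine (antitone_nat_of_succ_le fun N => ?_).le_of_tendsto (tendsto_zetaHalfApprox _) N
  rw [← sub_nonpos, zetaHalfApprox_succ_sub]
  set x := √(N + 1 : ℝ)
  set y := √(N + 1 + 1 : ℝ)
  have hx : 0 ≤ x := Real.sqrt_nonneg _
  have hxy : x ≤ y := Real.sqrt_le_sqrt (by linarith)
  refine mul_nonpos_of_nonpos_of_nonneg ?_ (div_nonneg (pow_nonneg (by linarith) _) (by positivity))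
  have h1 : 3 * (x * y) ≤ x ^ 2 + x * y + y ^ 2 := by nlinarith [sq_nonneg (x - y)]
  have h2 : 4 * (x * y) ≤ (x + y) ^ 2 := by nlinarith [sq_nonneg (x - y)]
  have h3 : 0 ≤ x * y := by positivity
  have := mul_le_mul h1 h2 (by positivity) (by positivity)
  nlinarith

/-- A coefficient slightly below `1/24` reverses the monotonicity once `N ≥ 2`. At `N = 8` the two
approximations differ by less than `3e-5`, enough for four decimals. -/
lemma approx_le_zeta_half {N : ℕ} (hN : 2 ≤ N) :
    zetaHalfApprox (41 / 1000) N ≤ (riemannZeta (1 / 2)).re := by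
  have hmono : Monotone fun k => zetaHalfApprox (41 / 1000) (k + 2) := by
    refine monotone_nat_of_le_succ fun k => ?_
    rw [← sub_nonneg, show k + 1 + 2 = (k + 2) + 1 by ring, zetaHalfApprox_succ_sub]
    set x := √((k + 2 : ℕ) + 1 : ℝ) with hx'
    set y := √((k + 2 : ℕ) + 1 + 1 : ℝ) with hy'
    have hk : (0 : ℝ) ≤ k := k.cast_nonneg
    have hx : x ^ 2 = k + 3 := by rw [hx', Real.sq_sqrt (by positivity)]; push_cast; ring
    have hy : y ^ 2 = k + 4 := by rw [hy', Real.sq_sqrt (by positivity)]; push_cast; ring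
    have hx0 : 0 ≤ x := Real.sqrt_nonneg _
    have hxy : x ≤ y := Real.sqrt_le_sqrt (by linarith)
    refine mul_nonneg ?_ (div_nonneg (pow_nonneg (by linarith) _) (by positivity))
    have hp : x * y ≤ k + 7 / 2 := by nlinarith [sq_nonneg (x - y)]
    have e1 : (x * y) ^ 2 = (k + 3) * (k + 4) := by rw [mul_pow, hx, hy]
    have e2 : (x ^ 2 + x * y + y ^ 2) * (x + y) ^ 2
        = (2 * k + 7 + x * y) * (2 * k + 7 + 2 * (x * y)) := by
      rw [add_sq, hx, hy]; ring
    rw [e1, e2]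
    have e3 : (2 * k + 7 + x * y) * (2 * k + 7 + 2 * (x * y))
        = (2 * k + 7) ^ 2 + 3 * (2 * k + 7) * (x * y) + 2 * ((k + 3) * (k + 4)) := by
      rw [← e1]; ring
    rw [e3]
    have e4 : 3 * (2 * k + 7) * (x * y) ≤ 3 * (2 * k + 7) * (k + 7 / 2) :=
      mul_le_mul_of_nonneg_left hp (by positivity)
    nlinarith
  have h := hmono.ge_of_tendsto
    ((tendsto_add_atTop_iff_nat 2).2 (tendsto_zetaHalfApprox (41 / 1000))) (N - 2)
  simpa [Nat.sub_add_cancel hN] using h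

lemma zetaHalfApprox_eight (c : ℝ) :
    zetaHalfApprox c 8 = 1 + √2 / 2 + √3 / 3 + 1 / 2 + √5 / 5 + √6 / 6 + √7 / 7 + √2 / 4
      - 6 + 1 / 6 + c / 27 := by
  have h4 : √4 = 2 := by rw [show (4 : ℝ) = 2 ^ 2 by norm_num, Real.sqrt_sq (by norm_num)]
  have h9 : √9 = 3 := by rw [show (9 : ℝ) = 3 ^ 2 by norm_num, Real.sqrt_sq (by norm_num)]
  have h8 : √8 = 2 * √2 := by
    rw [show (8 : ℝ) = 2 ^ 2 * 2 by norm_num, Real.sqrt_mul (by norm_num), Real.sqrt_sq (by norm_num)]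
  have hk : ∀ k : ℝ, 0 < k → 1 / √k = √k / k := fun k hk => by
    rw [eq_div_iff hk.ne', one_div, inv_mul_eq_div, Real.div_sqrt]
  simp only [zetaHalfApprox, Finset.sum_range_succ, Finset.sum_range_zero]
  norm_num [h4, h9]
  simp only [← one_div]
  rw [hk 2, hk 3, hk 5, hk 6, hk 7, hk 8, h8] <;> norm_num
  ring

lemma zeta_half_bounds :
    -1.4604 < (riemannZeta (1 / 2)).re ∧ (riemannZeta (1 / 2)).re ≤ -1.4603 := by
  have hu := zeta_half_le_approx 8
  have hl := approx_le_zeta_half (N := 8) (by norm_num)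
  rw [zetaHalfApprox_eight] at hu hl
  have lo : ∀ a k : ℝ, 0 ≤ a → a ^ 2 ≤ k → a ≤ √k := fun a k ha h => Real.le_sqrt_of_sq_le h
  have up : ∀ a k : ℝ, 0 ≤ a → k ≤ a ^ 2 → √k ≤ a := fun a k ha h => Real.sqrt_le_iff.2 ⟨ha, h⟩
  have l2 := lo 1.414213 2 (by norm_num) (by norm_num)
  have l3 := lo 1.732050 3 (by norm_num) (by norm_num)
  have l5 := lo 2.236067 5 (by norm_num) (by norm_num)
  have l6 := lo 2.449489 6 (by norm_num) (by norm_num)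
  have l7 := lo 2.645751 7 (by norm_num) (by norm_num)
  have u2 := up 1.414214 2 (by norm_num) (by norm_num)
  have u3 := up 1.732051 3 (by norm_num) (by norm_num)
  have u5 := up 2.236068 5 (by norm_num) (by norm_num)
  have u6 := up 2.449490 6 (by norm_num) (by norm_num)
  have u7 := up 2.645752 7 (by norm_num) (by norm_num)
  constructor <;> norm_num at * <;> linarith

/-! ### The symmetric binomial law as a random walk -/

/-- The average `E f (x + S_n)` over the position `S_n` of a simple symmetric random walk. -/
noncomputable def walkAvg (f : ℝ → ℝ) : ℕ → ℝ → ℝ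
  | 0, x => f x
  | n + 1, x => (walkAvg f n (x + 1) + walkAvg f n (x - 1)) / 2

lemma walkAvg_eq_sum (f : ℝ → ℝ) (n : ℕ) (x : ℝ) :
    walkAvg f n x = ∑ k ∈ Finset.range (n + 1), symBinomialMass n k * f (x + (2 * k - n)) := by
  induction n generalizing x with
  | zero => simp [walkAvg, symBinomialMass]
  | succ n ih =>
    -- The vanishing term `k = n + 1` is appended to the sum at `x - 1`, so that after an index
    -- shift Pascal's rule combines the two sums term by term.
    have hs := Finset.sum_range_succ (fun k => symBinomialMass n k * f (x - 1 + (2 * k - n))) (n + 1)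
    have h0 : symBinomialMass n (n + 1) = 0 := by simp [symBinomialMass]
    rw [h0, zero_mul, add_zero] at hs
    rw [walkAvg, ih, ih, ← hs, Finset.sum_range_succ' _ (n + 1), Finset.sum_range_succ' _ (n + 1),
      ← add_assoc, ← Finset.sum_add_distrib, add_div, Finset.sum_div]
    congr 1
    · refine Finset.sum_congr rfl fun k _ => ?_
      have e1 : x + 1 + (2 * (k : ℝ) - n) = x + (2 * ((k + 1 : ℕ) : ℝ) - ((n + 1 : ℕ) : ℝ)) := by
        push_cast; ring
      have e2 : x - 1 + (2 * ((k + 1 : ℕ) : ℝ) - n)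
          = x + (2 * ((k + 1 : ℕ) : ℝ) - ((n + 1 : ℕ) : ℝ)) := by
        push_cast; ring
      rw [e1, e2, ← add_mul]
      simp only [symBinomialMass, Nat.choose_succ_succ', pow_succ]
      push_cast
      field_simp
    · have e : x - 1 + (2 * ((0 : ℕ) : ℝ) - n) = x + (2 * ((0 : ℕ) : ℝ) - ((n + 1 : ℕ) : ℝ)) := by
        push_cast; ring
      rw [e]
      simp only [symBinomialMass, Nat.choose_zero_right, pow_succ]
      field_simp

lemma walkAvg_id (n : ℕ) (x : ℝ) : walkAvg (fun y => y) n x = x := by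
  induction n generalizing x with
  | zero => rfl
  | succ n ih => rw [walkAvg, ih, ih]; ring

lemma walkAvg_sq (n : ℕ) (x : ℝ) : walkAvg (fun y => y ^ 2) n x = x ^ 2 + n := by
  induction n generalizing x with
  | zero => simp [walkAvg]
  | succ n ih => rw [walkAvg, ih, ih]; push_cast; ring

lemma walkAvg_const (c : ℝ) (n : ℕ) (x : ℝ) : walkAvg (fun _ => c) n x = c := by
  induction n generalizing x with
  | zero => rfl
  | succ n ih => rw [walkAvg, ih, ih]; ring

lemma walkAvg_add (f g : ℝ → ℝ) (n : ℕ) (x : ℝ) :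
    walkAvg (fun y => f y + g y) n x = walkAvg f n x + walkAvg g n x := by
  simp only [walkAvg_eq_sum, mul_add, Finset.sum_add_distrib]

lemma walkAvg_const_mul (c : ℝ) (f : ℝ → ℝ) (n : ℕ) (x : ℝ) :
    walkAvg (fun y => c * f y) n x = c * walkAvg f n x := by
  simp only [walkAvg_eq_sum, Finset.mul_sum]
  exact Finset.sum_congr rfl fun k _ => by ring

lemma integral_symBinomial (f : ℝ → ℝ) (n : ℕ) :
    ∫ x, f x ∂(symBinomial n) = walkAvg (fun y => f ((y + n) / 2)) n 0 := by
  rw [symBinomial, integral_map_cast_binomial, walkAvg_eq_sum, Nat.range_succ_eq_Iic]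
  refine Finset.sum_congr rfl fun k hk => ?_
  have hkn : k ≤ n := by simpa using hk
  have e : (0 + (2 * (k : ℝ) - n) + n) / 2 = k := by ring
  rw [e, symBinomialMass, smul_eq_mul]
  congr 1
  have : (1 / 2 : ℝ) ^ k * (1 / 2) ^ (n - k) = 1 / 2 ^ n := by
    rw [← pow_add, Nat.add_sub_cancel' hkn, one_div_pow]
  norm_num only at *
  rw [mul_assoc, this]
  ring

instance isProbabilityMeasure_symBinomial (n : ℕ) : IsProbabilityMeasure (symBinomial n) := by
  unfold symBinomial; infer_instance

lemma integral_id_symBinomial (n : ℕ) : ∫ x, x ∂(symBinomial n) = n / 2 := by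
  rw [integral_symBinomial]
  have : (fun y : ℝ => (y + n) / 2) = fun y : ℝ => 1 / 2 * y + (n : ℝ) / 2 := by ext y; ring
  rw [this, walkAvg_add, walkAvg_const, walkAvg_const_mul, walkAvg_id]
  ring

lemma variance_symBinomial (n : ℕ) : variance (fun y : ℝ => y) (symBinomial n) = n / 4 := by
  rw [variance_eq_integral aemeasurable_id', integral_id_symBinomial, integral_symBinomial]
  have : (fun y : ℝ => ((y + n) / 2 - n / 2) ^ 2) = fun y => 1 / 4 * y ^ 2 := by ext y; ring
  rw [this, walkAvg_const_mul, walkAvg_sq]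
  ring

lemma integral_standardization_symBinomial {f : ℝ → ℝ} (hf : Continuous f) (n : ℕ) :
    ∫ x, f x ∂(standardization (symBinomial n)) = walkAvg (fun y => f (y / √n)) n 0 := by
  rw [standardization, integral_map (by fun_prop) hf.aestronglyMeasurable, integral_symBinomial,
    integral_id_symBinomial, variance_symBinomial]
  have h4 : √((n : ℝ) / 4) = √n / 2 := by
    rw [Real.sqrt_div' _ (by norm_num), show (4 : ℝ) = 2 ^ 2 by norm_num, Real.sqrt_sq (by norm_num)]
  congr 1
  ext y
  rw [h4]
  congr 1
  rw [← sub_div, add_sub_cancel_right, div_div_div_cancel_right₀ (by norm_num)]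

/-! ### The third absolute moment of the walk -/

/-- A telescoping antiderivative of `k ↦ C(n,k) (n - 2k)³`. -/
noncomputable def cubeAntidiff (n k : ℕ) : ℝ :=
  k * n.choose k * (4 * (k : ℝ) ^ 2 - 4 * (n + 1) * k + (n : ℝ) ^ 2 + 4 * n)

lemma succ_mul_choose_succ (n k : ℕ) (hk : k ≤ n) :
    ((k : ℝ) + 1) * n.choose (k + 1) = n.choose k * ((n : ℝ) - k) := by
  have h := Nat.choose_succ_right_eq n k
  have h2 : ((n.choose (k + 1) * (k + 1) : ℕ) : ℝ) = ((n.choose k * (n - k) : ℕ) : ℝ) := by rw [h]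
  push_cast [Nat.cast_sub hk] at h2
  linarith

lemma cubeAntidiff_succ_sub (n k : ℕ) (hk : k ≤ n) :
    cubeAntidiff n (k + 1) - cubeAntidiff n k = n.choose k * ((n : ℝ) - 2 * k) ^ 3 := by
  have h := succ_mul_choose_succ n k hk
  simp only [cubeAntidiff]
  push_cast
  rw [h]
  ring

/-- The summand telescopes with one sign up to the middle and with the other sign after it. The
antidifference vanishes at `0` and at `n + 1`, so twice its middle value remains. -/
lemma sum_choose_mul_abs_cube (n : ℕ) :
    ∑ k ∈ Finset.range (n + 1), (n.choose k : ℝ) * |2 * (k : ℝ) - n| ^ 3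
      = 2 * cubeAntidiff n (n / 2 + 1) := by
  have h1 : ∀ j, j ≤ n / 2 + 1 →
      ∑ k ∈ Finset.range j, (n.choose k : ℝ) * |2 * (k : ℝ) - n| ^ 3 = cubeAntidiff n j := by
    intro j
    induction j with
    | zero => simp [cubeAntidiff]
    | succ j ih =>
      intro hj
      have h2 : 2 * j ≤ n := by omega
      have h3 : (2 * (j : ℝ)) ≤ n := by exact_mod_cast h2
      rw [Finset.sum_range_succ, ih (by omega), abs_sub_comm, abs_of_nonneg (by linarith),
        ← cubeAntidiff_succ_sub n j (by omega)]
      ring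
  have h2 : ∀ j, n / 2 + 1 ≤ j → j ≤ n + 1 →
      ∑ k ∈ Finset.range j, (n.choose k : ℝ) * |2 * (k : ℝ) - n| ^ 3
        = 2 * cubeAntidiff n (n / 2 + 1) - cubeAntidiff n j := by
    intro j hj
    induction j, hj using Nat.le_induction with
    | base => intro _; rw [h1 _ le_rfl]; ring
    | succ j hj ih =>
      intro hjn
      have h2 : n ≤ 2 * j := by omega
      have h3 : (n : ℝ) ≤ 2 * (j : ℝ) := by exact_mod_cast h2
      rw [Finset.sum_range_succ, ih (by omega), abs_of_nonneg (by linarith)]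
      have := cubeAntidiff_succ_sub n j (by omega)
      linarith [show (n.choose j : ℝ) * (2 * (j : ℝ) - n) ^ 3
        = -(n.choose j * ((n : ℝ) - 2 * j) ^ 3) by ring]
  rw [h2 (n + 1) (by omega) le_rfl]
  simp [cubeAntidiff]

/-- `E |S_n|³` for the simple symmetric random walk. -/
lemma walkAvg_abs_cube (n : ℕ) :
    walkAvg (fun y => |y| ^ 3) n 0
      = (if Odd n then 2 * (n : ℝ) ^ 2 + n - 1 else 2 * (n : ℝ) ^ 2) * symBinomialMass n (n / 2) := by
  have h : walkAvg (fun y => |y| ^ 3) n 0 = 2 * cubeAntidiff n (n / 2 + 1) / 2 ^ n := by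
    rw [walkAvg_eq_sum, ← sum_choose_mul_abs_cube, Finset.sum_div]
    refine Finset.sum_congr rfl fun k _ => ?_
    rw [symBinomialMass, zero_add]
    ring
  rw [h, symBinomialMass, cubeAntidiff]
  have hc := succ_mul_choose_succ n (n / 2) (by omega)
  push_cast
  rw [hc]
  split_ifs with ho
  · obtain ⟨m, rfl⟩ := ho
    have : (2 * m + 1) / 2 = m := by omega
    rw [this]
    push_cast
    ring
  · obtain ⟨m, rfl⟩ := even_iff_two_dvd.1 (Nat.not_odd_iff_even.1 ho)
    have : 2 * m / 2 = m := by omega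
    rw [this]
    push_cast
    ring

/-! ### Gaussian moments -/

lemma integral_abs_pow_gaussianReal {v : NNReal} (hv : v ≠ 0) (k : ℕ) :
    ∫ x, |x| ^ k ∂(gaussianReal 0 v)
      = (√(2 * Real.pi * v))⁻¹ * ((1 / (2 * v) : ℝ) ^ (-((k : ℝ) + 1) / 2)
          * Real.Gamma (((k : ℝ) + 1) / 2)) := by
  have hv' : (0 : ℝ) < v := by positivity
  rw [integral_gaussianReal_eq_integral_smul hv]
  have h1 : ∀ x : ℝ, gaussianPDFReal 0 v x • |x| ^ k
      = (√(2 * Real.pi * v))⁻¹ * (fun y : ℝ => y ^ (k : ℝ) * Real.exp (-(1 / (2 * v)) * y ^ (2 : ℝ))) |x| := by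
    intro x
    simp only [gaussianPDFReal, smul_eq_mul, Real.rpow_natCast, Real.rpow_two, sq_abs, sub_zero]
    rw [show -x ^ 2 / (2 * (v : ℝ)) = -(1 / (2 * v)) * x ^ 2 by ring]
    ring
  simp_rw [h1]
  rw [integral_const_mul, integral_comp_abs (f := fun y : ℝ => y ^ (k : ℝ) *
    Real.exp (-(1 / (2 * v)) * y ^ (2 : ℝ))), integral_rpow_mul_exp_neg_mul_rpow (by norm_num)
    (by have : (0 : ℝ) ≤ k := k.cast_nonneg
        linarith) (by positivity)]
  ring

lemma integral_abs_gaussianReal {v : NNReal} (hv : v ≠ 0) :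
    ∫ x, |x| ∂(gaussianReal 0 v) = 2 * v / √(2 * Real.pi * v) := by
  have h := integral_abs_pow_gaussianReal hv 1
  have hv' : (0 : ℝ) < v := by positivity
  simp only [pow_one] at h
  rw [h]
  norm_num
  rw [Real.rpow_neg_one]
  field_simp

lemma integral_abs_cube_gaussianReal :
    ∫ x, |x| ^ 3 ∂(gaussianReal 0 1) = 4 / √(2 * Real.pi) := by
  rw [integral_abs_pow_gaussianReal one_ne_zero 3]
  norm_num
  ring

lemma integral_sq_gaussianReal : ∫ x, x ^ 2 ∂(gaussianReal 0 1) = 1 := by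
  have := variance_fun_id_gaussianReal (μ := 0) (v := 1)
  rw [variance_eq_integral aemeasurable_id', integral_id_gaussianReal] at this
  simpa using this

lemma integral_pow_four_gaussianReal : ∫ x, x ^ 4 ∂(gaussianReal 0 1) = 3 := by
  have h := integral_abs_pow_gaussianReal one_ne_zero 4
  have e : ∀ x : ℝ, |x| ^ 4 = x ^ 4 := fun x => by rw [Even.pow_abs ⟨2, rfl⟩]
  simp_rw [e] at h
  rw [h]
  have hG : Real.Gamma (((4 : ℕ) + 1 : ℝ) / 2) = 3 / 4 * √Real.pi := by
    rw [show ((4 : ℕ) + 1 : ℝ) / 2 = 1 / 2 + 1 + 1 by norm_num,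
      Real.Gamma_add_one (by norm_num), Real.Gamma_add_one (by norm_num), Real.Gamma_one_half_eq]
    ring
  have hp : (1 / (2 * ((1 : NNReal) : ℝ)) : ℝ) ^ (-(((4 : ℕ) : ℝ) + 1) / 2) = 4 * √2 := by
    rw [show (1 / (2 * ((1 : NNReal) : ℝ)) : ℝ) = 2⁻¹ by simp, Real.inv_rpow (by norm_num),
      ← Real.rpow_neg (by norm_num),
      show -(-(((4 : ℕ) : ℝ) + 1) / 2) = 2 + 1 / 2 by norm_num, Real.rpow_add (by norm_num),
      Real.sqrt_eq_rpow]
    norm_num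
  rw [hG, hp, NNReal.coe_one, mul_one, Real.sqrt_mul (by norm_num)]
  have := Real.sqrt_pos.2 Real.pi_pos
  field_simp

/-! ### The explicit lower bound as a difference of third moments -/

lemma natCast_rpow_three_half (n : ℕ) : (n : ℝ) ^ (3 / 2 : ℝ) = √n ^ 3 := by
  rw [Real.sqrt_eq_rpow, ← Real.rpow_natCast, ← Real.rpow_mul n.cast_nonneg]
  norm_num

lemma binomialNormalLower_eq_walkAvg {n : ℕ} (hn : 1 ≤ n) :
    binomialNormalLower n
      = 1 / 6 * |walkAvg (fun y => |y| ^ 3) n 0 / √n ^ 3 - 4 / √(2 * Real.pi)| := by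
  have hn0 : (0 : ℝ) < n := by exact_mod_cast hn
  set r := √(n : ℝ) with hr
  have hr0 : 0 < r := Real.sqrt_pos.2 hn0
  have hr2 : (n : ℝ) = r ^ 2 := (Real.sq_sqrt hn0.le).symm
  have e1 : (n : ℝ) ^ (1 / 2 : ℝ) = r := (Real.sqrt_eq_rpow _).symm
  have e2 : (n : ℝ) ^ (-1 / 2 : ℝ) = 1 / r := by
    rw [show (-1 / 2 : ℝ) = -(1 / 2) by norm_num, Real.rpow_neg hn0.le, e1, one_div]
  have e3 : (n : ℝ) ^ (-3 / 2 : ℝ) = 1 / r ^ 3 := by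
    rw [show (-3 / 2 : ℝ) = -(3 / 2) by norm_num, Real.rpow_neg hn0.le, natCast_rpow_three_half,
      one_div]
  rw [binomialNormalLower, walkAvg_abs_cube, e1, e2, e3]
  congr 1
  split_ifs with ho
  · congr 2
    rw [hr2]
    field_simp
  · congr 2
    rw [hr2]
    field_simp

lemma binomialNormalLower_eq_integral {n : ℕ} (hn : 1 ≤ n) :
    binomialNormalLower n = |∫ x, |x| ^ 3 / 6 ∂(standardization (symBinomial n))
      - ∫ x, |x| ^ 3 / 6 ∂(gaussianReal 0 1)| := by
  rw [binomialNormalLower_eq_walkAvg hn, integral_standardization_symBinomial (by fun_prop),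
    integral_div, integral_abs_cube_gaussianReal]
  have : (fun y : ℝ => |y / √(n : ℝ)| ^ 3 / 6) = fun y => (1 / (6 * √(n : ℝ) ^ 3)) * |y| ^ 3 := by
    ext y
    rw [abs_div, abs_of_nonneg (Real.sqrt_nonneg _), div_pow]
    ring
  rw [this, walkAvg_const_mul, ← abs_of_nonneg (by norm_num : (0 : ℝ) ≤ 1 / 6), ← abs_mul]
  congr 1
  ring

/-! ### Central binomial probabilities and the asymptotics of the lower bound -/

lemma symBinomialMass_succ_central (m : ℕ) :
    symBinomialMass (2 * (m + 1)) (m + 1)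
      = symBinomialMass (2 * m) m * ((2 * m + 1) / (2 * m + 2)) := by
  have h := Nat.succ_mul_centralBinom_succ m
  rw [Nat.centralBinom_eq_two_mul_choose, Nat.centralBinom_eq_two_mul_choose] at h
  have h2 : ((m : ℝ) + 1) * ((2 * (m + 1)).choose (m + 1) : ℝ)
      = 2 * (2 * m + 1) * ((2 * m).choose m : ℝ) := by exact_mod_cast h
  have hm : (0 : ℝ) < m + 1 := by positivity
  simp only [symBinomialMass]
  rw [show 2 * (m + 1) = 2 * m + 2 by ring] at *
  rw [pow_add]
  rw [show ((2 * m + 2).choose (m + 1) : ℝ) = 2 * (2 * m + 1) * ((2 * m).choose m : ℝ) / (m + 1) by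
    rw [← h2]; field_simp]
  field_simp

lemma symBinomialMass_odd_central (m : ℕ) :
    symBinomialMass (2 * m + 1) m = symBinomialMass (2 * (m + 1)) (m + 1) := by
  have h : (2 * (m + 1)).choose (m + 1) = 2 * (2 * m + 1).choose m := by
    rw [show 2 * (m + 1) = (2 * m + 1) + 1 by ring, Nat.choose_succ_succ', Nat.choose_symm_half]
    ring
  simp only [symBinomialMass, h]
  push_cast
  rw [show 2 * (m + 1) = (2 * m + 1) + 1 by ring, pow_succ _ (2 * m + 1), mul_comm (2 : ℝ),
    mul_div_mul_right _ _ two_ne_zero]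

lemma symBinomialMass_central_sq_mul_wallis (m : ℕ) :
    symBinomialMass (2 * m) m ^ 2 * (2 * m + 1) * Real.Wallis.W m = 1 := by
  induction m with
  | zero => simp [symBinomialMass, Real.Wallis.W]
  | succ m ih =>
    rw [symBinomialMass_succ_central, Real.Wallis.W_succ]
    have hm : (0 : ℝ) ≤ m := m.cast_nonneg
    refine Eq.trans ?_ ih
    push_cast
    field_simp
    ring

lemma tendsto_symBinomialMass_central_sq_mul {e : ℕ → ℝ} {c : ℝ}
    (he : Tendsto (fun m => e m / (2 * m + 1)) atTop (nhds c)) :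
    Tendsto (fun m : ℕ => symBinomialMass (2 * m) m ^ 2 * e m) atTop (nhds (2 * c / Real.pi)) := by
  have h := he.div Real.Wallis.tendsto_W_nhds_pi_div_two (by positivity)
  rw [show 2 * c / Real.pi = c / (Real.pi / 2) by field_simp]
  refine h.congr fun m => ?_
  have h1 := symBinomialMass_central_sq_mul_wallis m
  have hW := Real.Wallis.W_pos m
  have hm : (0 : ℝ) ≤ m := m.cast_nonneg
  rw [Pi.div_apply, div_div, div_eq_iff (by positivity)]
  linear_combination (-(e m)) * h1

lemma tendsto_inv_two_mul_add_one : Tendsto (fun m : ℕ => 1 / (2 * (m : ℝ) + 1)) atTop (nhds 0) :=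
  (tendsto_atTop_add_const_right _ _
    (tendsto_natCast_atTop_atTop.const_mul_atTop (by norm_num : (0 : ℝ) < 2))).const_div_atTop 1

/-- The product without `π` increases to `1/π` by Wallis. The shift `1/4` cancels all but the
constant term in the comparison of consecutive values. -/
lemma symBinomialMass_central_sq_le (m : ℕ) :
    Real.pi * symBinomialMass (2 * m) m ^ 2 * (m + 1 / 4) ≤ 1 := by
  have hmono : Monotone fun m : ℕ => symBinomialMass (2 * m) m ^ 2 * ((m : ℝ) + 1 / 4) := by
    refine monotone_nat_of_le_succ fun m => ?_
    rw [symBinomialMass_succ_central, mul_pow, mul_assoc]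
    gcongr
    have hm : (0 : ℝ) ≤ m := m.cast_nonneg
    push_cast
    rw [div_pow, div_mul_eq_mul_div, le_div_iff₀ (by positivity)]
    nlinarith
  have ht : Tendsto (fun m : ℕ => ((m : ℝ) + 1 / 4) / (2 * m + 1)) atTop (nhds (1 / 2)) := by
    have := (tendsto_inv_two_mul_add_one.const_mul (-(1 / 4))).const_add (1 / 2)
    rw [mul_zero, add_zero] at this
    refine this.congr fun m => ?_
    have hm : (0 : ℝ) ≤ m := m.cast_nonneg
    field_simp
    ring
  have h := hmono.ge_of_tendsto (tendsto_symBinomialMass_central_sq_mul ht) m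
  simp only [mul_one_div] at h
  rw [le_div_iff₀ Real.pi_pos] at h
  linarith

lemma le_symBinomialMass_central_sq {m : ℕ} (hm : 1 ≤ m) :
    1 ≤ Real.pi * symBinomialMass (2 * m) m ^ 2 * (m + 1 / 4 + 1 / (4 * m)) := by
  set u : ℕ → ℝ := fun m => symBinomialMass (2 * m) m ^ 2 * ((m : ℝ) + 1 / 4 + 1 / (4 * m)) with hu
  -- The index starts at 1: at `m = 0` the junk value `1 / 0 = 0` would break monotonicity.
  have hanti : Antitone fun k : ℕ => u (k + 1) := by
    refine antitone_nat_of_succ_le fun k => ?_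
    simp only [hu]
    rw [symBinomialMass_succ_central (k + 1), mul_pow, mul_assoc]
    gcongr
    have hk : (0 : ℝ) ≤ k := k.cast_nonneg
    push_cast
    rw [← sub_nonneg]
    have : (k : ℝ) + 1 + 1 / 4 + 1 / (4 * (k + 1)) - ((2 * ((k : ℝ) + 1) + 1) / (2 * (k + 1) + 2)) ^ 2
        * (k + 1 + 1 + 1 / 4 + 1 / (4 * (k + 1 + 1)))
        = (7 * ((k : ℝ) + 1) ^ 2 + 10 * (k + 1) + 4) / (4 * (k + 1) * (2 * k + 4) ^ 2 * (k + 2)) := by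
      field_simp
      ring
    rw [this]
    positivity
  have ht : Tendsto (fun m : ℕ => ((m : ℝ) + 1 / 4 + 1 / (4 * m)) / (2 * m + 1)) atTop
      (nhds (1 / 2)) := by
    have h2 : Tendsto (fun m : ℕ => 1 / (4 * (m : ℝ))) atTop (nhds 0) :=
      (tendsto_natCast_atTop_atTop.const_mul_atTop (by norm_num : (0 : ℝ) < 4)).const_div_atTop 1
    have := ((tendsto_inv_two_mul_add_one.const_mul (-(1 / 4))).const_add (1 / 2)).add
      (h2.mul tendsto_inv_two_mul_add_one)
    rw [mul_zero, add_zero, mul_zero, add_zero] at this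
    refine this.congr fun m => ?_
    have hm : (0 : ℝ) ≤ m := m.cast_nonneg
    generalize 1 / (4 * (m : ℝ)) = w
    field_simp
    ring
  have h := hanti.le_of_tendsto
    ((tendsto_add_atTop_iff_nat 1).2 (tendsto_symBinomialMass_central_sq_mul ht)) (m - 1)
  rw [Nat.sub_add_cancel hm] at h
  simp only [mul_one_div, hu] at h
  rw [div_le_iff₀ Real.pi_pos] at h
  linarith

lemma even_upper_rational {x : ℝ} (hx : 1 ≤ x) :
    2 * x / (2 * x + 1) ≤ (1 - 1 / (4 * x)) ^ 2 + 2 / x ^ 2 := by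
  -- Here and in the next three lemmas, the shift `x = t + 1` leaves, after clearing denominators, a
  -- polynomial in `t` with nonnegative coefficients.
  obtain ⟨t, ht, rfl⟩ : ∃ t : ℝ, 0 ≤ t ∧ x = t + 1 := ⟨x - 1, by linarith, by ring⟩
  rw [← sub_nonneg]
  field_simp
  ring_nf
  positivity

lemma even_lower_rational {x : ℝ} (hx : 1 ≤ x) :
    (1 - 1 / (4 * x)) ^ 2 - 2 / x ^ 2 ≤ 2 * x ^ 2 / (2 * x ^ 2 + x + 2) := by
  obtain ⟨t, ht, rfl⟩ : ∃ t : ℝ, 0 ≤ t ∧ x = t + 1 := ⟨x - 1, by linarith, by ring⟩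
  rw [← sub_nonneg]
  field_simp
  ring_nf
  positivity

lemma odd_upper_rational {x : ℝ} (hx : 1 ≤ x) :
    (2 * x ^ 2 + x - 1) ^ 2 / (2 * x ^ 3 * (2 * x + 3)) ≤ (1 - 1 / (4 * x)) ^ 2 + 2 / x ^ 2 := by
  obtain ⟨t, ht, rfl⟩ : ∃ t : ℝ, 0 ≤ t ∧ x = t + 1 := ⟨x - 1, by linarith, by ring⟩
  rw [← sub_nonneg]
  field_simp
  ring_nf
  positivity

lemma odd_lower_rational {x : ℝ} (hx : 1 ≤ x) :
    (1 - 1 / (4 * x)) ^ 2 - 2 / x ^ 2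
      ≤ (2 * x ^ 2 + x - 1) ^ 2 * (x + 1) / (2 * x ^ 3 * (2 * x ^ 2 + 5 * x + 5)) := by
  obtain ⟨t, ht, rfl⟩ : ∃ t : ℝ, 0 ≤ t ∧ x = t + 1 := ⟨x - 1, by linarith, by ring⟩
  rw [← sub_nonneg]
  field_simp
  ring_nf
  positivity

/-- This is the expansion of the standardized third absolute moment divided by its Gaussian value
`4/√(2π)`, namely `1 - 1/(4n) + O(n⁻²)`. It is squared because the Wallis bounds control squares,
and the factor `π/8` is the inverse square of the Gaussian value. -/
lemma abs_walkAvg_abs_cube_sq_sub_le {n : ℕ} (hn : 1 ≤ n) :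
    |Real.pi / 8 * (walkAvg (fun y => |y| ^ 3) n 0 / √n ^ 3) ^ 2 - (1 - 1 / (4 * n)) ^ 2|
      ≤ 2 / (n : ℝ) ^ 2 := by
  have hn1 : (1 : ℝ) ≤ n := by exact_mod_cast hn
  have hs : (√(n : ℝ) ^ 3) ^ 2 = (n : ℝ) ^ 3 := by
    rw [← pow_mul, mul_comm, pow_mul, Real.sq_sqrt n.cast_nonneg]
  rw [div_pow, hs, walkAvg_abs_cube]
  have hpi := Real.pi_pos
  split_ifs with ho
  · obtain ⟨m, rfl⟩ := ho
    -- The odd central probability equals the even one at `2 * (m + 1) = n + 1`, so the even bounds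
    -- apply at `m + 1`.
    rw [show (2 * m + 1) / 2 = m by omega, symBinomialMass_odd_central, mul_pow]
    have hu := symBinomialMass_central_sq_le (m + 1)
    have hl := le_symBinomialMass_central_sq (m := m + 1) (by omega)
    have hr1 := odd_upper_rational hn1
    have hr2 := odd_lower_rational hn1
    set x : ℝ := ((2 * m + 1 : ℕ) : ℝ) with hx
    set p : ℝ := symBinomialMass (2 * (m + 1)) (m + 1) ^ 2 with hp
    have hm : ((m + 1 : ℕ) : ℝ) = (x + 1) / 2 := by rw [hx]; push_cast; ring
    rw [hm] at hu hl
    have hx0 : 0 < x := by linarith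
    have hU : Real.pi * p ≤ 4 / (2 * x + 3) := by
      rw [le_div_iff₀ (by positivity)]; linarith
    have hL : 4 * (x + 1) / (2 * x ^ 2 + 5 * x + 5) ≤ Real.pi * p := by
      rw [div_le_iff₀ (by positivity)]
      have e : (x + 1) / 2 + 1 / 4 + 1 / (4 * ((x + 1) / 2))
        = (2 * x ^ 2 + 5 * x + 5) / (4 * (x + 1)) := by field_simp; ring
      rw [e, mul_div_assoc', le_div_iff₀ (by positivity)] at hl
      linarith
    have e0 : Real.pi / 8 * ((2 * x ^ 2 + x - 1) ^ 2 * p / x ^ 3)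
        = (2 * x ^ 2 + x - 1) ^ 2 / (8 * x ^ 3) * (Real.pi * p) := by field_simp
    have hc : 0 ≤ (2 * x ^ 2 + x - 1) ^ 2 / (8 * x ^ 3) := by positivity
    rw [e0, abs_le]
    constructor
    · have := mul_le_mul_of_nonneg_left hL hc
      have e : (2 * x ^ 2 + x - 1) ^ 2 / (8 * x ^ 3) * (4 * (x + 1) / (2 * x ^ 2 + 5 * x + 5))
        = (2 * x ^ 2 + x - 1) ^ 2 * (x + 1) / (2 * x ^ 3 * (2 * x ^ 2 + 5 * x + 5)) := by
        field_simp; ring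
      linarith
    · have := mul_le_mul_of_nonneg_left hU hc
      have e : (2 * x ^ 2 + x - 1) ^ 2 / (8 * x ^ 3) * (4 / (2 * x + 3))
        = (2 * x ^ 2 + x - 1) ^ 2 / (2 * x ^ 3 * (2 * x + 3)) := by field_simp; ring
      linarith
  · obtain ⟨m, rfl⟩ := even_iff_two_dvd.1 (Nat.not_odd_iff_even.1 ho)
    rw [show 2 * m / 2 = m by omega, mul_pow]
    have hu := symBinomialMass_central_sq_le m
    have hl := le_symBinomialMass_central_sq (m := m) (by omega)
    have hr1 := even_upper_rational hn1
    have hr2 := even_lower_rational hn1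
    set x : ℝ := ((2 * m : ℕ) : ℝ) with hx
    set p : ℝ := symBinomialMass (2 * m) m ^ 2 with hp
    have hm : (m : ℝ) = x / 2 := by rw [hx]; push_cast; ring
    rw [hm] at hu hl
    have hx0 : 0 < x := by linarith
    have hU : Real.pi * p ≤ 4 / (2 * x + 1) := by
      rw [le_div_iff₀ (by positivity)]; linarith
    have hL : 4 * x / (2 * x ^ 2 + x + 2) ≤ Real.pi * p := by
      rw [div_le_iff₀ (by positivity)]
      have e : x / 2 + 1 / 4 + 1 / (4 * (x / 2)) = (2 * x ^ 2 + x + 2) / (4 * x) := by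
        field_simp; ring
      rw [e, mul_div_assoc', le_div_iff₀ (by positivity)] at hl
      linarith
    have e0 : Real.pi / 8 * ((2 * x ^ 2) ^ 2 * p / x ^ 3) = x / 2 * (Real.pi * p) := by
      field_simp; norm_num
    rw [e0, abs_le]
    constructor
    · have := mul_le_mul_of_nonneg_left hL (by positivity : 0 ≤ x / 2)
      have e : x / 2 * (4 * x / (2 * x ^ 2 + x + 2)) = 2 * x ^ 2 / (2 * x ^ 2 + x + 2) := by
        field_simp; ring
      linarith
    · have := mul_le_mul_of_nonneg_left hU (by positivity : 0 ≤ x / 2)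
      have e : x / 2 * (4 / (2 * x + 1)) = 2 * x / (2 * x + 1) := by field_simp; ring
      linarith

lemma walkAvg_nonneg {f : ℝ → ℝ} (hf : ∀ y, 0 ≤ f y) (n : ℕ) (x : ℝ) : 0 ≤ walkAvg f n x := by
  induction n generalizing x with
  | zero => exact hf x
  | succ n ih => rw [walkAvg]; linarith [ih (x + 1), ih (x - 1)]

lemma binomialNormalLower_isBigO :
    (fun n : ℕ => binomialNormalLower n - 1 / (6 * √(2 * Real.pi) * n))
      =O[atTop] fun n : ℕ => 1 / (n : ℝ) ^ 2 := by
  refine IsBigO.of_bound 2 ?_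
  filter_upwards [eventually_ge_atTop 1] with n hn
  have hn1 : (1 : ℝ) ≤ n := by exact_mod_cast hn
  have hA := abs_walkAvg_abs_cube_sq_sub_le hn
  rw [binomialNormalLower_eq_walkAvg hn]
  have hA0 : 0 ≤ walkAvg (fun y => |y| ^ 3) n 0 / √n ^ 3 :=
    div_nonneg (walkAvg_nonneg (fun _ => by positivity) _ _) (by positivity)
  set A := walkAvg (fun y => |y| ^ 3) n 0 / √n ^ 3
  have hs0 : 0 < √(2 * Real.pi) := Real.sqrt_pos.2 (by positivity)
  have hs2 : √(2 * Real.pi) ^ 2 = 2 * Real.pi := Real.sq_sqrt (by positivity)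
  set k := 4 / √(2 * Real.pi) with hk
  have hk0 : 0 < k := by positivity
  have hk2 : Real.pi / 8 * k ^ 2 = 1 := by
    rw [hk, div_pow, hs2]; field_simp; norm_num
  have hk3 : k ≤ 2 := by
    rw [hk, div_le_iff₀ hs0]
    nlinarith [Real.pi_gt_three]
  set w := 1 - 1 / (4 * (n : ℝ)) with hw
  have hw0 : 3 / 4 ≤ w := by
    have : 1 / (4 * (n : ℝ)) ≤ 1 / 4 := by
      apply one_div_le_one_div_of_le <;> linarith
    linarith
  have e1 : Real.pi / 8 * A ^ 2 - w ^ 2 = Real.pi / 8 * (A + k * w) * (A - k * w) := by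
    linear_combination w ^ 2 * hk2
  have hb : k * (3 / 4) ≤ A + k * w := by
    have := mul_le_mul_of_nonneg_left hw0 hk0.le
    linarith
  have h1 : Real.pi / 8 * (k * (3 / 4)) * |A - k * w| ≤ 2 / (n : ℝ) ^ 2 := by
    refine le_trans ?_ hA
    rw [e1, abs_mul, abs_mul, abs_of_pos (by positivity : 0 < Real.pi / 8),
      abs_of_nonneg (by linarith [mul_pos hk0 (by norm_num : (0 : ℝ) < 3 / 4)] : 0 ≤ A + k * w)]
    gcongr
  -- From `π * k² = 8` and `k ≤ 2` one has `π * k ≥ 4`.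
  have h2 : 3 / 8 * |A - k * w| ≤ 2 / (n : ℝ) ^ 2 := by
    refine le_trans ?_ h1
    gcongr
    nlinarith
  have h3 : 1 / 6 * |A - k| - 1 / (6 * √(2 * Real.pi) * n) = 1 / 6 * (|A - k| - k / (4 * n)) := by
    rw [hk]; field_simp
  have h4 : |(|A - k| - k / (4 * n))| ≤ |A - k * w| := by
    have e : A - k * w = (A - k) - (-(k / (4 * n))) := by rw [hw]; field_simp; ring
    rw [e]
    have := abs_abs_sub_abs_le_abs_sub (A - k) (-(k / (4 * n)))
    rwa [abs_neg, abs_of_nonneg (by positivity : 0 ≤ k / (4 * (n : ℝ)))] at this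
  rw [h3, Real.norm_eq_abs, Real.norm_eq_abs, abs_mul, abs_of_pos (by norm_num : (0 : ℝ) < 1 / 6),
    abs_of_nonneg (by positivity : 0 ≤ 1 / (n : ℝ) ^ 2)]
  have e5 : 2 / (n : ℝ) ^ 2 = 2 * (1 / (n : ℝ) ^ 2) := by ring
  rw [e5] at h2
  have : 0 ≤ 1 / (n : ℝ) ^ 2 := by positivity
  linarith

/-! ### Comparing one `±1` step with one normal step -/

/-- By evenness `d' 0 = 0`, and `d'` is convex on `[0, ∞)`, so `d' t / t` is nondecreasing there.
Hence `d t - d' 1 / 2 * t²` falls up to `t = 1` and rises afterwards. -/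
lemma quadratic_minorant {d d' d'' : ℝ → ℝ} (h1 : ∀ t, HasDerivAt d (d' t) t)
    (h2 : ∀ t, HasDerivAt d' (d'' t) t) (heven : ∀ t, d (-t) = d t)
    (hmono : MonotoneOn d'' (Set.Ici 0)) (t : ℝ) : d 1 + d' 1 / 2 * (t ^ 2 - 1) ≤ d t := by
  wlog ht : 0 ≤ t generalizing t with H
  · rw [← heven t, ← neg_sq t]
    exact H (-t) (by linarith)
  have hd0 : d' 0 = 0 := by
    have hneg : HasDerivAt (fun t => d (-t)) (d' (-0) * -1) (0 : ℝ) := by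
      exact (h1 (-0)).comp 0 (hasDerivAt_neg 0)
    simp_rw [heven] at hneg
    have := hneg.unique (h1 0)
    rw [neg_zero] at this
    linarith
  have hconv : ConvexOn ℝ (Set.Ici 0) d' := by
    refine MonotoneOn.convexOn_of_deriv (convex_Ici 0)
      (fun x _ => (h2 x).continuousAt.continuousWithinAt)
      (fun x _ => (h2 x).differentiableAt.differentiableWithinAt) ?_
    intro a ha b hb hab
    rw [(h2 a).deriv, (h2 b).deriv]
    exact hmono (interior_subset ha) (interior_subset hb) hab
  have hslope : ∀ a b, 0 ≤ a → a ≤ b → 0 < b → d' a * b ≤ d' b * a := by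
    intro a b ha hab hb
    have := hconv.2 (Set.mem_Ici.2 hb.le) (Set.mem_Ici.2 le_rfl) (div_nonneg ha hb.le)
      (sub_nonneg.2 ((div_le_one hb).2 hab)) (by ring)
    simp only [smul_eq_mul, mul_zero, add_zero, hd0] at this
    rw [div_mul_cancel₀ _ hb.ne'] at this
    calc d' a * b ≤ a / b * d' b * b := by gcongr
      _ = d' b * a := by field_simp
  have hφ : ∀ x, HasDerivAt (fun t => d t - d' 1 / 2 * (t ^ 2 - 1)) (d' x - d' 1 * x) x := by
    intro x
    have := (h1 x).sub ((((hasDerivAt_pow 2 x).sub_const 1)).const_mul (d' 1 / 2))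
    refine this.congr_deriv ?_
    simp; ring
  have hφd : Differentiable ℝ (fun t => d t - d' 1 / 2 * (t ^ 2 - 1)) :=
    fun x => (hφ x).differentiableAt
  suffices h : d 1 - d' 1 / 2 * (1 ^ 2 - 1) ≤ d t - d' 1 / 2 * (t ^ 2 - 1) by linarith
  rcases le_total t 1 with h | h
  · refine antitoneOn_of_deriv_nonpos (convex_Icc 0 1) hφd.continuous.continuousOn
      hφd.differentiableOn ?_ (Set.mem_Icc.2 ⟨ht, h⟩) (Set.right_mem_Icc.2 zero_le_one) h
    intro x hx
    rw [interior_Icc] at hx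
    rw [(hφ x).deriv]
    linarith [hslope x 1 hx.1.le hx.2.le one_pos]
  · refine monotoneOn_of_deriv_nonneg (convex_Ici 1) hφd.continuous.continuousOn
      hφd.differentiableOn ?_ (Set.mem_Ici.2 le_rfl) (Set.mem_Ici.2 h) h
    intro x hx
    rw [interior_Ici] at hx
    have hx1 : 1 < x := hx
    rw [(hφ x).deriv]
    linarith [hslope 1 x zero_le_one hx1.le (by linarith)]

lemma integrable_abs_pow_gaussianReal (v : NNReal) (k : ℕ) :
    Integrable (fun x => |x| ^ k) (gaussianReal 0 v) := by
  have := (memLp_id_gaussianReal (μ := 0) (v := v) k).integrable_norm_pow'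
  simpa using this

/-- In the integrated minorant the quadratic part drops out, since the standard normal law has
second moment 1. -/
lemma apply_one_le_integral_gaussianReal {d d' d'' : ℝ → ℝ} (h1 : ∀ t, HasDerivAt d (d' t) t)
    (h2 : ∀ t, HasDerivAt d' (d'' t) t) (heven : ∀ t, d (-t) = d t)
    (hmono : MonotoneOn d'' (Set.Ici 0)) (hint : Integrable d (gaussianReal 0 1)) :
    d 1 ≤ ∫ z, d z ∂(gaussianReal 0 1) := by
  have hsq : Integrable (fun x : ℝ => x ^ 2) (gaussianReal 0 1) := by
    simpa using integrable_abs_pow_gaussianReal 1 2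
  have hsqs : Integrable (fun x : ℝ => x ^ 2 - 1) (gaussianReal 0 1) :=
    hsq.sub (integrable_const _)
  calc d 1 = ∫ z, (d 1 + d' 1 / 2 * (z ^ 2 - 1)) ∂(gaussianReal 0 1) := by
        rw [integral_add (integrable_const _) (hsqs.const_mul _),
          integral_const_mul, integral_sub hsq (integrable_const _), integral_sq_gaussianReal]
        simp
    _ ≤ _ := integral_mono
        ((integrable_const _).add (hsqs.const_mul _)) hint
        (quadratic_minorant h1 h2 heven hmono)

lemma integral_gaussianReal_comp_neg (f : ℝ → ℝ) (v : NNReal) :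
    ∫ z, f (-z) ∂(gaussianReal 0 v) = ∫ z, f z ∂(gaussianReal 0 v) := by
  conv_rhs => rw [← neg_zero (G := ℝ), ← gaussianReal_map_neg]
  exact ((MeasurableEquiv.neg ℝ).measurableEmbedding.integral_map f).symm

/-- Both expectations are unchanged when `f (x + ·)` is replaced by its even part. Adding that part
to `H` and subtracting it from `H` gives the two sides of the estimate. -/
lemma abs_integral_gaussianReal_sub_avg_le {f f' f'' H H' H'' : ℝ → ℝ}
    (h1 : ∀ t, HasDerivAt f (f' t) t) (h2 : ∀ t, HasDerivAt f' (f'' t) t)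
    (hH1 : ∀ t, HasDerivAt H (H' t) t) (hH2 : ∀ t, HasDerivAt H' (H'' t) t)
    (hHeven : ∀ t, H (-t) = H t) (hHint : Integrable H (gaussianReal 0 1))
    (x : ℝ) (hfint : Integrable (fun z => f (x + z)) (gaussianReal 0 1))
    (hadd : MonotoneOn (fun t => H'' t + (f'' (x + t) + f'' (x - t)) / 2) (Set.Ici 0))
    (hsub : MonotoneOn (fun t => H'' t - (f'' (x + t) + f'' (x - t)) / 2) (Set.Ici 0)) :
    |∫ z, f (x + z) ∂(gaussianReal 0 1) - (f (x + 1) + f (x - 1)) / 2|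
      ≤ ∫ z, H z ∂(gaussianReal 0 1) - H 1 := by
  have hfint' : Integrable (fun z => f (x - z)) (gaussianReal 0 1) := by
    have h := hfint
    rw [← neg_zero (G := ℝ), ← gaussianReal_map_neg] at h
    exact h.comp_measurable measurable_neg
  have hs1 : ∀ t, HasDerivAt (fun t => (f (x + t) + f (x - t)) / 2)
      ((f' (x + t) - f' (x - t)) / 2) t := by
    intro t
    have := (((h1 (x + t)).comp_const_add x t).add ((h1 (x - t)).comp_const_sub x t)).div_const 2
    simpa [sub_eq_add_neg] using this
  have hs2 : ∀ t, HasDerivAt (fun t => (f' (x + t) - f' (x - t)) / 2)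
      ((f'' (x + t) + f'' (x - t)) / 2) t := by
    intro t
    have := (((h2 (x + t)).comp_const_add x t).sub ((h2 (x - t)).comp_const_sub x t)).div_const 2
    simpa using this
  have hsi : Integrable (fun t => (f (x + t) + f (x - t)) / 2) (gaussianReal 0 1) :=
    (hfint.add hfint').div_const 2
  have hsint : ∫ t, (f (x + t) + f (x - t)) / 2 ∂(gaussianReal 0 1)
      = ∫ z, f (x + z) ∂(gaussianReal 0 1) := by
    rw [integral_div, integral_add hfint hfint']
    have := integral_gaussianReal_comp_neg (fun z => f (x + z)) 1
    simp only [← sub_eq_add_neg] at this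
    rw [this]
    ring
  have hp := apply_one_le_integral_gaussianReal (fun t => (hH1 t).add (hs1 t))
    (fun t => (hH2 t).add (hs2 t))
    (fun t => by simp only [Pi.add_apply, hHeven, sub_neg_eq_add, ← sub_eq_add_neg]; ring) hadd (hHint.add hsi)
  have hm := apply_one_le_integral_gaussianReal (fun t => (hH1 t).sub (hs1 t))
    (fun t => (hH2 t).sub (hs2 t))
    (fun t => by simp only [Pi.sub_apply, hHeven, sub_neg_eq_add, ← sub_eq_add_neg]; ring) hsub (hHint.sub hsi)
  simp only [Pi.add_apply, Pi.sub_apply] at hp hm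
  rw [integral_add hHint hsi, hsint] at hp
  rw [integral_sub hHint hsi, hsint] at hm
  rw [abs_le]
  constructor <;> linarith

lemma hasDerivAt_mul_abs (t : ℝ) : HasDerivAt (fun t : ℝ => t * |t|) (2 * |t|) t := by
  -- The derivative at the kink `0` is obtained by continuity from the derivative elsewhere.
  refine hasDerivAt_of_hasDerivAt_of_ne' (f := fun t : ℝ => t * |t|) (g := fun t => 2 * |t|)
    (x := 0) (fun y hy => ?_) (by fun_prop) (by fun_prop) t
  have := (hasDerivAt_id y).mul (hasDerivAt_abs hy)
  refine this.congr_deriv ?_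
  simp only [id]
  rw [self_mul_sign]
  ring

lemma hasDerivAt_abs_cube_div (t : ℝ) :
    HasDerivAt (fun t : ℝ => |t| ^ 3 / 6) (t * |t| / 2) t := by
  have h := ((hasDerivAt_id t).mul (hasDerivAt_mul_abs t)).div_const 6
  have e : (fun t : ℝ => |t| ^ 3 / 6) = fun t => ((id : ℝ → ℝ) * fun t : ℝ => t * |t|) t / 6 := by
    ext t
    simp only [Pi.mul_apply, id]
    rw [pow_succ, sq_abs]; ring
  rw [e]
  refine h.congr_deriv ?_
  simp only [id]; ring

/-- Bounded test functions with bounded first and second derivatives, the second derivative being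
Lipschitz with constant `1`. -/
structure IsLipschitzTest (f f' f'' : ℝ → ℝ) : Prop where
  hasDerivAt : ∀ t, HasDerivAt f (f' t) t
  hasDerivAt' : ∀ t, HasDerivAt f' (f'' t) t
  lipschitz : ∀ x y, |f'' x - f'' y| ≤ |x - y|
  bounded : ∃ C, ∀ x, |f x| ≤ C
  bounded' : ∃ C, ∀ x, |f' x| ≤ C
  bounded'' : ∃ C, ∀ x, |f'' x| ≤ C

namespace IsLipschitzTest

variable {f f' f'' : ℝ → ℝ}

lemma continuous (h : IsLipschitzTest f f' f'') : Continuous f :=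
  continuous_iff_continuousAt.2 fun t => (h.hasDerivAt t).continuousAt

lemma continuous' (h : IsLipschitzTest f f' f'') : Continuous f' :=
  continuous_iff_continuousAt.2 fun t => (h.hasDerivAt' t).continuousAt

lemma continuous'' (h : IsLipschitzTest f f' f'') : Continuous f'' :=
  (LipschitzWith.of_dist_le_mul (K := 1) fun x y => by
    simpa [Real.dist_eq] using h.lipschitz x y).continuous

end IsLipschitzTest

lemma integrable_of_continuous_of_bounded {f : ℝ → ℝ} (hf : Continuous f) {C : ℝ}
    (hC : ∀ x, |f x| ≤ C) (μ : Measure ℝ) [IsFiniteMeasure μ] : Integrable f μ :=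
  Integrable.of_bound hf.aestronglyMeasurable C (ae_of_all _ hC)

/-- Comparison of a Rademacher with a standard normal variable, for one test function. -/
lemma IsLipschitzTest.abs_integral_sub_avg_le {f f' f'' : ℝ → ℝ} (h : IsLipschitzTest f f' f'')
    (x : ℝ) : |∫ z, f (x + z) ∂(gaussianReal 0 1) - (f (x + 1) + f (x - 1)) / 2|
      ≤ (4 / √(2 * Real.pi) - 1) / 6 := by
  obtain ⟨C, hC⟩ := h.bounded
  have hc := h.continuous
  have hbd : ∀ a b : ℝ, 0 ≤ a → a ≤ b →
      |(f'' (x + b) + f'' (x - b)) / 2 - (f'' (x + a) + f'' (x - a)) / 2| ≤ b - a := by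
    intro a b _ hab
    have e1 := h.lipschitz (x + b) (x + a)
    have e2 := h.lipschitz (x - b) (x - a)
    rw [show x + b - (x + a) = b - a by ring, abs_of_nonneg (by linarith : 0 ≤ b - a)] at e1
    rw [show x - b - (x - a) = -(b - a) by ring, abs_neg,
      abs_of_nonneg (by linarith : 0 ≤ b - a)] at e2
    rw [abs_le] at *
    constructor <;> linarith [e1.1, e1.2, e2.1, e2.2]
  -- The symmetrized `f''` is 1-Lipschitz on `[0, ∞)`, so adding it to, or subtracting it from, `H''
  -- = |t|` keeps the latter nondecreasing there.
  have key := abs_integral_gaussianReal_sub_avg_le h.hasDerivAt h.hasDerivAt'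
    hasDerivAt_abs_cube_div (H'' := fun t => |t|)
    (fun t => by simpa using (hasDerivAt_mul_abs t).div_const 2)
    (fun t => by rw [abs_neg]) ((integrable_abs_pow_gaussianReal 1 3).div_const 6) x
    (integrable_of_continuous_of_bounded (by fun_prop) (fun z => hC (x + z)) _)
    (fun a ha b hb hab => by
      have ha' : 0 ≤ a := ha
      have hb' : 0 ≤ b := hb
      have := (abs_le.1 (hbd a b ha hab)).1
      simp only [abs_of_nonneg ha', abs_of_nonneg hb']
      linarith)
    (fun a ha b hb hab => by
      have ha' : 0 ≤ a := ha
      have hb' : 0 ≤ b := hb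
      have := (abs_le.1 (hbd a b ha hab)).2
      simp only [abs_of_nonneg ha', abs_of_nonneg hb']
      linarith)
  rw [integral_div, integral_abs_cube_gaussianReal] at key
  refine key.trans_eq ?_
  norm_num
  ring

/-! ### The gain from Gaussian smoothing -/

lemma hasDerivAt_integral_comp_add {f f' : ℝ → ℝ} (h : ∀ t, HasDerivAt f (f' t) t)
    (hc : Continuous f') {C C' : ℝ} (hC : ∀ x, |f x| ≤ C) (hC' : ∀ x, |f' x| ≤ C')
    (μ : Measure ℝ) [IsProbabilityMeasure μ] (x : ℝ) :
    HasDerivAt (fun x => ∫ y, f (x + y) ∂μ) (∫ y, f' (x + y) ∂μ) x := by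
  have hfc : Continuous f := continuous_iff_continuousAt.2 fun t => (h t).continuousAt
  refine (hasDerivAt_integral_of_dominated_loc_of_deriv_le (F := fun x y => f (x + y))
    (F' := fun x y => f' (x + y)) (bound := fun _ => C') (s := Set.univ) univ_mem
    (Eventually.of_forall fun x => ?_) ?_ ?_ (ae_of_all _ fun y x _ => hC' _)
    (integrable_const _) (ae_of_all _ fun y x _ => (h (x + y)).comp_add_const x y)).2
  · exact Continuous.aestronglyMeasurable (by fun_prop)
  · exact integrable_of_continuous_of_bounded (by fun_prop) (fun y => hC (x + y)) _
  · exact Continuous.aestronglyMeasurable (by fun_prop)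

lemma hasDerivAt_gaussianPDFReal_sub {v : NNReal} (hv : v ≠ 0) (z x : ℝ) :
    HasDerivAt (fun x => gaussianPDFReal 0 v (z - x)) (gaussianPDFReal 0 v (z - x) * ((z - x) / v)) x := by
  have hv' : (0 : ℝ) < v := by positivity
  unfold gaussianPDFReal
  have h1 : HasDerivAt (fun x : ℝ => -(z - x - 0) ^ 2 / (2 * v)) ((z - x) / v) x := by
    have := (((((hasDerivAt_id x).const_sub z).sub_const 0).pow 2).neg).div_const (2 * (v : ℝ))
    refine this.congr_deriv ?_
    simp
    field_simp
  have := (h1.exp).const_mul (√(2 * Real.pi * v))⁻¹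
  refine this.congr_deriv ?_
  ring

/-- As `F` is only continuous, the integral is rewritten as a convolution with the Gaussian density,
and the derivative falls on the density. -/
lemma hasDerivAt_integral_gaussianReal {F : ℝ → ℝ} (hF : Continuous F) {C : ℝ}
    (hC : ∀ x, |F x| ≤ C) {v : NNReal} (hv : v ≠ 0) (x : ℝ) :
    HasDerivAt (fun x => ∫ y, F (x + y) ∂(gaussianReal 0 v))
      (∫ y, F (x + y) * (y / v) ∂(gaussianReal 0 v)) x := by
  have hv' : (0 : ℝ) < v := by positivity
  have hφc : Continuous (gaussianPDFReal 0 v) := by unfold gaussianPDFReal; fun_prop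
  have hC0 : 0 ≤ C := (abs_nonneg _).trans (hC 0)
  have e1 : ∀ x, ∫ y, F (x + y) ∂(gaussianReal 0 v) = ∫ z, F z * gaussianPDFReal 0 v (z - x) := by
    intro x
    rw [integral_gaussianReal_eq_integral_smul hv,
      ← integral_sub_right_eq_self (fun y => gaussianPDFReal 0 v y • F (x + y)) x]
    refine integral_congr_ae (ae_of_all _ fun z => ?_)
    simp only [smul_eq_mul, add_sub_cancel]
    ring
  have e2 : ∫ y, F (x + y) * (y / v) ∂(gaussianReal 0 v)
      = ∫ z, F z * (gaussianPDFReal 0 v (z - x) * ((z - x) / v)) := by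
    rw [integral_gaussianReal_eq_integral_smul hv,
      ← integral_sub_right_eq_self (fun y => gaussianPDFReal 0 v y • (F (x + y) * (y / v))) x]
    refine integral_congr_ae (ae_of_all _ fun z => ?_)
    simp only [smul_eq_mul, add_sub_cancel]
    ring
  rw [funext e1, e2]
  -- Domination over `|y - x| < 1`: by `(z - y)² ≥ (z - x)²/2 - 1`, the Gaussian factor is at most
  -- `exp (1/(2v))` times one of doubled variance centred at `x`.
  set K : ℝ := C * ((√(2 * Real.pi * v))⁻¹ * Real.exp (1 / (2 * v)) / v) with hK
  have hbi : Integrable (fun w : ℝ => K * ((|w| + 1) * Real.exp (-(1 / (4 * v)) * w ^ 2))) := by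
    refine Integrable.const_mul ?_ _
    have hb : 0 < 1 / (4 * (v : ℝ)) := by positivity
    have i1 := (integrable_mul_exp_neg_mul_sq hb).norm
    have i2 := integrable_exp_neg_mul_sq hb
    refine (i1.add i2).congr (ae_of_all _ fun w => ?_)
    simp only [Pi.add_apply, norm_mul, Real.norm_eq_abs, Real.abs_exp]
    ring
  refine (hasDerivAt_integral_of_dominated_loc_of_deriv_le
    (F := fun x z => F z * gaussianPDFReal 0 v (z - x))
    (F' := fun x z => F z * (gaussianPDFReal 0 v (z - x) * ((z - x) / v)))
    (bound := fun z => K * ((|z - x| + 1) * Real.exp (-(1 / (4 * v)) * (z - x) ^ 2)))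
    (s := Metric.ball x 1) (Metric.ball_mem_nhds x one_pos)
    (Eventually.of_forall fun x => ?_) ?_ ?_ (ae_of_all _ fun z y hy => ?_)
    (hbi.comp_sub_right x) (ae_of_all _ fun z y _ => ?_)).2
  · exact Continuous.aestronglyMeasurable (by fun_prop)
  · refine Integrable.bdd_mul (c := C) ?_ hF.aestronglyMeasurable (ae_of_all _ hC)
    exact (integrable_gaussianPDFReal 0 v).comp_sub_right x
  · exact Continuous.aestronglyMeasurable (by fun_prop)
  · rw [Metric.mem_ball, Real.dist_eq] at hy
    rw [norm_mul, norm_mul, Real.norm_eq_abs, Real.norm_eq_abs, Real.norm_eq_abs,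
      abs_of_nonneg (gaussianPDFReal_nonneg 0 v _), abs_div, abs_of_pos hv']
    have hw : |z - y| ≤ |z - x| + 1 := by
      have : z - y = (z - x) - (y - x) := by ring
      rw [this]
      exact (abs_sub _ _).trans (by linarith)
    have hyx : (y - x) ^ 2 ≤ 1 := by
      rw [← sq_abs]; nlinarith [abs_nonneg (y - x)]
    have hsq : (z - x) ^ 2 / 2 - 1 ≤ (z - y) ^ 2 := by
      have : z - x = (z - y) + (y - x) := by ring
      rw [this]
      nlinarith [sq_nonneg ((z - y) - (y - x))]
    have hexp : Real.exp (-(z - y - 0) ^ 2 / (2 * v))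
        ≤ Real.exp (1 / (2 * v)) * Real.exp (-(1 / (4 * v)) * (z - x) ^ 2) := by
      rw [← Real.exp_add, Real.exp_le_exp]
      have : 1 / (2 * (v : ℝ)) + -(1 / (4 * v)) * (z - x) ^ 2
          = -((z - x) ^ 2 / 2 - 1) / (2 * v) := by field_simp; ring
      rw [this, sub_zero]
      gcongr
    calc |F z| * (gaussianPDFReal 0 v (z - y) * (|z - y| / v))
        ≤ C * (((√(2 * Real.pi * v))⁻¹ * (Real.exp (1 / (2 * v))
            * Real.exp (-(1 / (4 * v)) * (z - x) ^ 2))) * ((|z - x| + 1) / v)) := by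
          unfold gaussianPDFReal
          gcongr
          exact hC z
      _ = _ := by rw [hK]; ring
  · exact (hasDerivAt_gaussianPDFReal_sub hv z y).const_mul (F z)

/-- Comparison of a Rademacher with a standard normal variable, for one test function that has been
smoothed by a centred normal law. -/
lemma IsLipschitzTest.abs_integral_smoothed_sub_avg_le {f f' f'' : ℝ → ℝ}
    (h : IsLipschitzTest f f' f'') {v : NNReal} (hv : v ≠ 0) (x : ℝ) :
    |∫ z, ∫ y, f (x + z + y) ∂(gaussianReal 0 v) ∂(gaussianReal 0 1)
        - (∫ y, f (x + 1 + y) ∂(gaussianReal 0 v) + ∫ y, f (x - 1 + y) ∂(gaussianReal 0 v)) / 2|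
      ≤ 1 / (6 * √(2 * Real.pi * v)) := by
  obtain ⟨C, hC⟩ := h.bounded
  obtain ⟨C', hC'⟩ := h.bounded'
  obtain ⟨C'', hC''⟩ := h.bounded''
  have hv' : (0 : ℝ) < v := by positivity
  set μ := gaussianReal 0 v with hμ
  set q : ℝ → ℝ := fun x => ∫ y, f'' (x + y) ∂μ with hq
  set q' : ℝ → ℝ := fun x => ∫ y, f'' (x + y) * (y / v) ∂μ with hq'
  have hg1 := hasDerivAt_integral_comp_add h.hasDerivAt h.continuous' hC hC' μ
  have hg2 := hasDerivAt_integral_comp_add h.hasDerivAt' h.continuous'' hC' hC'' μ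
  have hg3 : ∀ x, HasDerivAt q (q' x) x :=
    hasDerivAt_integral_gaussianReal h.continuous'' hC'' hv
  -- `M = E|Y| / v` for `Y` of law `N(0, v)`: a Lipschitz constant of the third derivative `q'` of
  -- the smoothed function.
  set M : ℝ := 2 / √(2 * Real.pi * v) with hM
  have hyi : Integrable (fun y : ℝ => y / v) μ := by
    have : Integrable (fun y : ℝ => y) μ := by
      have := integrable_abs_pow_gaussianReal v 1
      simp only [pow_one] at this
      exact (integrable_norm_iff (by fun_prop)).1 this
    exact this.div_const _
  have hlip : ∀ a b, |q' a - q' b| ≤ M * |a - b| := by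
    have hi : ∀ a, Integrable (fun y => f'' (a + y) * (y / v)) μ := fun a =>
      Integrable.bdd_mul (c := C'') hyi
        (h.continuous''.comp (by fun_prop : Continuous fun y : ℝ => a + y)).aestronglyMeasurable
        (ae_of_all _ fun y => hC'' (a + y))
    intro a b
    rw [hq', ← integral_sub (hi a) (hi b)]
    calc |∫ y, (f'' (a + y) * (y / v) - f'' (b + y) * (y / v)) ∂μ|
        ≤ ∫ y, |a - b| * (|y| / v) ∂μ := by
          refine norm_integral_le_of_norm_le (μ := μ)
            (f := fun y => f'' (a + y) * (y / v) - f'' (b + y) * (y / v)) ((hyi.abs.const_mul |a - b|).congr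
            (ae_of_all _ fun y => ?_))
            (ae_of_all _ fun y => ?_)
          · simp only [abs_div, abs_of_pos hv']
          · rw [← sub_mul, Real.norm_eq_abs, abs_mul, abs_div, abs_of_pos hv']
            have := h.lipschitz (a + y) (b + y)
            rw [add_sub_add_right_eq_sub] at this
            exact mul_le_mul_of_nonneg_right this (by positivity)
      _ = M * |a - b| := by
          rw [integral_const_mul, integral_div, hμ, integral_abs_gaussianReal hv, hM]
          field_simp
  have hs : ∀ t, HasDerivAt (fun t => (q (x + t) + q (x - t)) / 2)
      ((q' (x + t) - q' (x - t)) / 2) t := by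
    intro t
    have := (((hg3 (x + t)).comp_const_add x t).add ((hg3 (x - t)).comp_const_sub x t)).div_const 2
    simpa [sub_eq_add_neg] using this
  have hH3 : ∀ t, HasDerivAt (fun t : ℝ => M * t ^ 2 / 2) (M * t) t := by
    intro t
    have := ((hasDerivAt_pow 2 t).const_mul M).div_const 2
    refine this.congr_deriv ?_
    simp; ring
  have hbd : ∀ t, 0 < t → |(q' (x + t) - q' (x - t)) / 2| ≤ M * t := by
    intro t ht
    rw [abs_div, abs_two, div_le_iff₀ two_pos]
    refine (hlip _ _).trans_eq ?_
    rw [show x + t - (x - t) = 2 * t by ring, abs_of_pos (by positivity)]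
    ring
  have hgc : Continuous fun x => ∫ y, f (x + y) ∂μ :=
    continuous_iff_continuousAt.2 fun t => (hg1 t).continuousAt
  -- `H` is chosen with `H''' = M * t`, which dominates the third derivative of the symmetrized
  -- function. The error is `M * (3 - 1) / 24`, as the fourth Gaussian moment is 3.
  have key := abs_integral_gaussianReal_sub_avg_le hg1 hg2 (H := fun t => M * t ^ 4 / 24)
    (H' := fun t => M * t ^ 3 / 6) (H'' := fun t => M * t ^ 2 / 2)
    (fun t => by
      have := ((hasDerivAt_pow 4 t).const_mul M).div_const 24
      refine this.congr_deriv ?_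
      norm_num; ring)
    (fun t => by
      have := ((hasDerivAt_pow 3 t).const_mul M).div_const 6
      refine this.congr_deriv ?_
      norm_num; ring)
    (fun t => by ring)
    ((((integrable_abs_pow_gaussianReal 1 4).congr
      (ae_of_all _ fun z => Even.pow_abs ⟨2, rfl⟩ z)).const_mul M).div_const 24) x
    (integrable_of_continuous_of_bounded (C := C)
      (hgc.comp (by fun_prop : Continuous fun z : ℝ => x + z)) (fun z => by
        have := norm_integral_le_of_norm_le_const (μ := μ) (f := fun y => f (x + z + y))
          (ae_of_all _ fun y => hC (x + z + y))
        simpa using this) _)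
    (by
      refine monotoneOn_of_hasDerivWithinAt_nonneg (convex_Ici 0) (fun t _ => ((hH3 t).add (hs t)).continuousAt.continuousWithinAt)
        (fun t _ => ((hH3 t).add (hs t)).hasDerivWithinAt) fun t ht => ?_
      rw [interior_Ici] at ht
      linarith [(abs_le.1 (hbd t ht)).1])
    (by
      refine monotoneOn_of_hasDerivWithinAt_nonneg (convex_Ici 0) (fun t _ => ((hH3 t).sub (hs t)).continuousAt.continuousWithinAt)
        (fun t _ => ((hH3 t).sub (hs t)).hasDerivWithinAt) fun t ht => ?_
      rw [interior_Ici] at ht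
      linarith [(abs_le.1 (hbd t ht)).2])
  rw [integral_div, integral_const_mul, integral_pow_four_gaussianReal] at key
  refine key.trans_eq ?_
  rw [hM]
  field_simp
  norm_num

/-! ### Lindeberg replacement -/

lemma integral_gaussianReal_add {f : ℝ → ℝ} (hf : Continuous f) {C : ℝ} (hC : ∀ x, |f x| ≤ C)
    (v w : NNReal) (x : ℝ) :
    ∫ y, f (x + y) ∂(gaussianReal 0 (v + w))
      = ∫ z, ∫ y, f (x + z + y) ∂(gaussianReal 0 w) ∂(gaussianReal 0 v) := by
  have h := gaussianReal_conv_gaussianReal (m₁ := 0) (m₂ := 0) (v₁ := v) (v₂ := w)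
  rw [add_zero] at h
  rw [← h, integral_conv]
  · simp only [add_assoc]
  · exact integrable_of_continuous_of_bounded (by fun_prop) (fun y => hC (x + y)) _

/-- The Lindeberg replacement argument. -/
lemma IsLipschitzTest.abs_walkAvg_sub_le {f f' f'' : ℝ → ℝ} (h : IsLipschitzTest f f' f'')
    (m : ℕ) (x : ℝ) :
    |walkAvg f (m + 1) x - ∫ y, f (x + y) ∂(gaussianReal 0 ((m + 1 : ℕ) : NNReal))|
      ≤ (4 / √(2 * Real.pi) - 1) / 6
        + ∑ k ∈ Finset.range m, 1 / (6 * √(2 * Real.pi * ((k + 1 : ℕ) : NNReal))) := by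
  induction m generalizing x with
  | zero =>
    -- With a single step there is no normal part to smooth `f`, so the unsmoothed estimate is used.
    rw [abs_sub_comm]
    simpa [walkAvg] using h.abs_integral_sub_avg_le x
  | succ m ih =>
    obtain ⟨C, hC⟩ := h.bounded
    have hconv := integral_gaussianReal_add h.continuous hC 1 ((m + 1 : ℕ) : NNReal) x
    rw [show (1 : NNReal) + ((m + 1 : ℕ) : NNReal) = ((m + 1 + 1 : ℕ) : NNReal) by
      push_cast; ring] at hconv
    rw [hconv, walkAvg, Finset.sum_range_succ]
    -- The last `m + 1` steps are replaced by induction from both `x + 1` and `x - 1`; the remaining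
    -- first step then acts on `f` smoothed by variance `m + 1`.
    have hs := h.abs_integral_smoothed_sub_avg_le (v := ((m + 1 : ℕ) : NNReal))
      (by exact_mod_cast Nat.succ_ne_zero m) x
    have h1 := ih (x + 1)
    have h2 := ih (x - 1)
    rw [abs_le] at *
    constructor <;> linarith [hs.1, hs.2, h1.1, h1.2, h2.1, h2.2]

/-! ### The Zolotarev class of order 3 and its scaling -/

lemma mem_boundedZolotarevClass_three {f : ℝ → ℝ} :
    f ∈ BoundedZolotarevClass 3 ↔ (ContDiff ℝ 2 f ∧
      ∀ x y, |deriv (deriv f) x - deriv (deriv f) y| ≤ |x - y|) ∧ ∃ C, ∀ x, |f x| ≤ C := by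
  have hc : ⌈(3 : ℝ) - 1⌉₊ = 2 := by
    rw [show (3 : ℝ) - 1 = 2 by norm_num, Nat.ceil_ofNat]
  have hi : iteratedDeriv 2 f = deriv (deriv f) := by
    rw [iteratedDeriv_succ, iteratedDeriv_one]
  have he : (3 : ℝ) - (2 : ℕ) = 1 := by norm_num
  simp only [BoundedZolotarevClass, ZolotarevClass, hc, hi, he, Set.mem_ofPred_eq, Real.rpow_one]
  norm_cast

/-- The missing bounds come from interpolation: every unit interval contains a point where `|f'| ≤
2C`. Two such points at distance more than 1 enclose one where `|f''| ≤ 4C`, and the Lipschitz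
condition spreads this bound. -/
lemma IsLipschitzTest.of_mem {f : ℝ → ℝ} (hf : f ∈ BoundedZolotarevClass 3) :
    IsLipschitzTest f (deriv f) (deriv (deriv f)) := by
  obtain ⟨⟨hcd, hlip⟩, C, hC⟩ := mem_boundedZolotarevClass_three.1 hf
  have h1 : ∀ t, HasDerivAt f (deriv f t) t := fun t =>
    (hcd.differentiable (by norm_num) t).hasDerivAt
  have hcd' : ContDiff ℝ 1 (deriv f) := hcd.deriv'
  have h2 : ∀ t, HasDerivAt (deriv f) (deriv (deriv f) t) t := fun t =>
    (hcd'.differentiable (by norm_num) t).hasDerivAt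
  have hsmall : ∀ x, ∃ ξ ∈ Set.Ioo x (x + 1), |deriv f ξ| ≤ 2 * C := by
    intro x
    obtain ⟨ξ, hξ, he⟩ := exists_hasDerivAt_eq_slope f (deriv f) (lt_add_one x)
      hcd.continuous.continuousOn fun t _ => h1 t
    refine ⟨ξ, hξ, ?_⟩
    rw [he, add_sub_cancel_left, div_one]
    exact (abs_sub _ _).trans (by linarith [hC x, hC (x + 1)])
  have hb2 : ∀ x, |deriv (deriv f) x| ≤ 4 * C + 3 := by
    intro x
    obtain ⟨ξ, hξ, h3⟩ := hsmall x
    obtain ⟨ξ', hξ', h4⟩ := hsmall (x + 2)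
    have hlt : 1 < ξ' - ξ := by linarith [hξ.2, hξ'.1]
    obtain ⟨η, hη, he⟩ := exists_hasDerivAt_eq_slope (deriv f) (deriv (deriv f))
      (by linarith : ξ < ξ') hcd'.continuous.continuousOn fun t _ => h2 t
    have h5 : |deriv (deriv f) η| ≤ 4 * C := by
      rw [he, abs_div, abs_of_pos (by linarith : 0 < ξ' - ξ)]
      have h6 : |deriv f ξ' - deriv f ξ| ≤ 4 * C := (abs_sub _ _).trans (by linarith)
      exact (div_le_self (abs_nonneg _) hlt.le).trans h6
    have h7 : |x - η| ≤ 3 := by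
      rw [abs_le]; constructor <;> linarith [hη.1, hη.2, hξ.1, hξ.2, hξ'.1, hξ'.2]
    have h8 := abs_sub_abs_le_abs_sub (deriv (deriv f) x) (deriv (deriv f) η)
    linarith [hlip x η]
  refine ⟨h1, h2, hlip, ⟨C, hC⟩, ⟨2 * C + (4 * C + 3), fun x => ?_⟩, ⟨_, hb2⟩⟩
  obtain ⟨ξ, hξ, h3⟩ := hsmall x
  have h4 := convex_univ.norm_image_sub_le_of_norm_hasDerivWithin_le
    (fun t _ => (h2 t).hasDerivWithinAt) (fun t _ => hb2 t) (Set.mem_univ ξ) (Set.mem_univ x)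
  have h5 : ‖x - ξ‖ ≤ 1 := by
    rw [Real.norm_eq_abs, abs_le]; constructor <;> linarith [hξ.1, hξ.2]
  have h6 := abs_sub_abs_le_abs_sub (deriv f x) (deriv f ξ)
  have h7 : 0 ≤ 4 * C + 3 := (abs_nonneg _).trans (hb2 0)
  rw [Real.norm_eq_abs] at h4
  nlinarith

lemma IsLipschitzTest.mem {f f' f'' : ℝ → ℝ} (h : IsLipschitzTest f f' f'') :
    f ∈ BoundedZolotarevClass 3 := by
  have e1 : deriv f = f' := funext fun t => (h.hasDerivAt t).deriv
  have e2 : deriv f' = f'' := funext fun t => (h.hasDerivAt' t).deriv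
  rw [mem_boundedZolotarevClass_three, e1, e2]
  refine ⟨⟨?_, h.lipschitz⟩, h.bounded⟩
  rw [show (2 : WithTop ℕ∞) = 1 + 1 by norm_num, contDiff_succ_iff_deriv, e1, contDiff_one_iff_deriv,
    e2]
  exact ⟨fun t => (h.hasDerivAt t).differentiableAt, by simp,
    fun t => (h.hasDerivAt' t).differentiableAt, h.continuous''⟩

/-- This homogeneity of degree 3 passes between the walk and its standardization and produces the
factor `n^(-3/2)`; it also rescales the test functions for the lower bound. -/
lemma IsLipschitzTest.scale {f f' f'' : ℝ → ℝ} (h : IsLipschitzTest f f' f'') {c : ℝ} (hc : 0 < c) :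
    IsLipschitzTest (fun x => c ^ 3 * f (x / c)) (fun x => c ^ 2 * f' (x / c))
      (fun x => c * f'' (x / c)) := by
  have hbd : ∀ (k : ℝ) (g : ℝ → ℝ), (∃ C, ∀ x, |g x| ≤ C) → ∃ C, ∀ x, |k * g (x / c)| ≤ C := by
    rintro k g ⟨C, hC⟩
    refine ⟨|k| * C, fun x => ?_⟩
    rw [abs_mul]
    exact mul_le_mul_of_nonneg_left (hC _) (abs_nonneg _)
  refine ⟨fun t => ?_, fun t => ?_, fun x y => ?_, hbd _ _ h.bounded, hbd _ _ h.bounded',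
    hbd _ _ h.bounded''⟩
  · refine (((h.hasDerivAt (t / c)).comp t ((hasDerivAt_id t).div_const c)).const_mul
      (c ^ 3)).congr_deriv ?_
    field_simp
  · refine (((h.hasDerivAt' (t / c)).comp t ((hasDerivAt_id t).div_const c)).const_mul
      (c ^ 2)).congr_deriv ?_
    field_simp
  · rw [← mul_sub, abs_mul, abs_of_pos hc]
    have := h.lipschitz (x / c) (y / c)
    rw [← sub_div, abs_div, abs_of_pos hc, le_div_iff₀ hc] at this
    linarith

lemma integral_gaussianReal_div_sqrt {f : ℝ → ℝ} {n : ℕ} (hn : 1 ≤ n) (hf : Continuous f) :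
    ∫ y, f (y / √n) ∂(gaussianReal 0 (n : NNReal)) = ∫ y, f y ∂(gaussianReal 0 1) := by
  have hn0 : (0 : ℝ) < n := by exact_mod_cast hn
  have h := gaussianReal_map_div_const (μ := 0) (v := (n : NNReal)) (√(n : ℝ))
  have e : (n : NNReal) / NNReal.mk (√(n : ℝ) ^ 2) (sq_nonneg _) = 1 := by
    rw [← NNReal.coe_inj]
    rw [NNReal.coe_div, NNReal.coe_natCast, NNReal.coe_one, NNReal.coe_mk, Real.sq_sqrt hn0.le,
      div_self hn0.ne']
  rw [zero_div, e] at h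
  rw [← h, integral_map (by fun_prop) hf.aestronglyMeasurable]

lemma IsLipschitzTest.abs_integral_standardization_sub_le {f f' f'' : ℝ → ℝ}
    (h : IsLipschitzTest f f' f'') (m : ℕ) :
    |∫ x, f x ∂(standardization (symBinomial (m + 1))) - ∫ x, f x ∂(gaussianReal 0 1)|
      ≤ ((4 / √(2 * Real.pi) - 1) / 6
        + ∑ k ∈ Finset.range m, 1 / (6 * √(2 * Real.pi * ((k + 1 : ℕ) : NNReal))))
        / √((m + 1 : ℕ) : ℝ) ^ 3 := by
  have hc : 0 < √((m + 1 : ℕ) : ℝ) := Real.sqrt_pos.2 (by positivity)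
  have key := (h.scale hc).abs_walkAvg_sub_le m 0
  simp only [zero_add] at key
  rw [walkAvg_const_mul, integral_const_mul, integral_gaussianReal_div_sqrt (by omega) h.continuous,
    ← integral_standardization_symBinomial h.continuous, ← mul_sub, abs_mul,
    abs_of_pos (by positivity)] at key
  rw [le_div_iff₀ (by positivity)]
  linarith

/-! ### The upper bound and its numerical form -/

lemma lindeberg_bound_lt (m : ℕ) :
    ((4 / √(2 * Real.pi) - 1) / 6
        + ∑ k ∈ Finset.range m, 1 / (6 * √(2 * Real.pi * ((k + 1 : ℕ) : NNReal))))
        / √((m + 1 : ℕ) : ℝ) ^ 3 < binomialNormalUpper (m + 1) := by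
  have hn0 : (0 : ℝ) < ((m + 1 : ℕ) : ℝ) := by positivity
  have hs0 : 0 < √(2 * Real.pi) := Real.sqrt_pos.2 (by positivity)
  have hsum : ∑ k ∈ Finset.range m, 1 / (6 * √(2 * Real.pi * ((k + 1 : ℕ) : NNReal)))
      = (∑ k ∈ Finset.range m, 1 / √(k + 1 : ℝ)) / (6 * √(2 * Real.pi)) := by
    rw [Finset.sum_div]
    refine Finset.sum_congr rfl fun k _ => ?_
    rw [Real.sqrt_mul (by positivity), NNReal.coe_natCast]
    push_cast
    rw [div_div]
    congr 1
    ring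
  have hz := sum_one_div_sqrt_lt m
  rw [hsum, binomialNormalUpper, natCast_rpow_three_half]
  have hcast : ((m + 1 : ℕ) : ℝ) = m + 1 := by push_cast; ring
  rw [← hcast] at hz
  set r := √((m + 1 : ℕ) : ℝ) with hr
  have hr0 : 0 < r := Real.sqrt_pos.2 hn0
  have hr2 : ((m + 1 : ℕ) : ℝ) = r ^ 2 := (Real.sq_sqrt hn0.le).symm
  rw [hr2, div_lt_iff₀ (by positivity)]
  have e : (1 / (3 * √(2 * Real.pi) * r ^ 2)
      + ((4 + (riemannZeta (1 / 2)).re) / √(2 * Real.pi) - 1) * (1 / (6 * r ^ 3))) * r ^ 3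
      = (4 / √(2 * Real.pi) - 1) / 6
        + (2 * r + (riemannZeta (1 / 2)).re) / (6 * √(2 * Real.pi)) := by
    field_simp
    ring
  rw [e]
  gcongr

lemma binomialNormalUpper_lt_and_le {n : ℕ} (hn : 1 ≤ n) :
    binomialNormalUpper n < 0.1330 / n + 0.0022 / (n : ℝ) ^ (3 / 2 : ℝ) ∧
      0.1330 / (n : ℝ) + 0.0022 / (n : ℝ) ^ (3 / 2 : ℝ) ≤ 0.1352 / n := by
  have hn1 : (1 : ℝ) ≤ n := by exact_mod_cast hn
  have hn0 : (0 : ℝ) < n := by linarith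
  have hs : 2.506614 < √(2 * Real.pi) := by
    apply Real.lt_sqrt_of_sq_lt
    have := Real.pi_gt_d6
    norm_num at *
    linarith
  have hs0 : 0 < √(2 * Real.pi) := by linarith
  have hp0 : 0 < (n : ℝ) ^ (3 / 2 : ℝ) := Real.rpow_pos_of_pos hn0 _
  constructor
  · have h1 : 1 / (3 * √(2 * Real.pi) * n) < 0.1330 / n := by
      rw [← div_div]
      gcongr
      rw [div_lt_iff₀ (by positivity)]
      norm_num at *
      linarith
    have h2 : ((4 + (riemannZeta (1 / 2)).re) / √(2 * Real.pi) - 1)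
        * (1 / (6 * (n : ℝ) ^ (3 / 2 : ℝ))) < 0.0022 / (n : ℝ) ^ (3 / 2 : ℝ) := by
      -- The threshold is exact for the target: `(1.0132 - 1) / 6 = 0.0022`.
      have h3 : (4 + (riemannZeta (1 / 2)).re) / √(2 * Real.pi) < 1.0132 := by
        rw [div_lt_iff₀ hs0]
        have := zeta_half_bounds.2
        norm_num at *
        linarith
      rw [mul_one_div, ← div_div]
      gcongr
      norm_num at *
      linarith
    rw [binomialNormalUpper]
    linarith
  · have h1 : (n : ℝ) ≤ (n : ℝ) ^ (3 / 2 : ℝ) := by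
      conv_lhs => rw [← Real.rpow_one (n : ℝ)]
      exact Real.rpow_le_rpow_of_exponent_le hn1 (by norm_num)
    have h2 : 0.0022 / (n : ℝ) ^ (3 / 2 : ℝ) ≤ 0.0022 / n := by gcongr
    have h3 : (0.1352 : ℝ) / n = 0.1330 / n + 0.0022 / n := by rw [← add_div]; norm_num
    linarith

lemma binomialNormalDist_lt {n : ℕ} (hn : 1 ≤ n) :
    binomialNormalDist n < ENNReal.ofReal (binomialNormalUpper n) := by
  obtain ⟨m, rfl⟩ : ∃ m, n = m + 1 := ⟨n - 1, by omega⟩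
  set B : ℝ := ((4 / √(2 * Real.pi) - 1) / 6
        + ∑ k ∈ Finset.range m, 1 / (6 * √(2 * Real.pi * ((k + 1 : ℕ) : NNReal))))
        / √((m + 1 : ℕ) : ℝ) ^ 3 with hB
  have hle : binomialNormalDist (m + 1) ≤ ENNReal.ofReal B :=
    iSup₂_le fun f hf => ENNReal.ofReal_le_ofReal
      ((IsLipschitzTest.of_mem hf).abs_integral_standardization_sub_le m)
  have hlt : B < binomialNormalUpper (m + 1) := lindeberg_bound_lt m
  -- The estimate for the zero test function shows `0 ≤ B`, so the strict inequality survives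
  -- `ENNReal.ofReal`.
  have hB0 : 0 ≤ B := by
    have h0 : IsLipschitzTest (fun _ : ℝ => (0 : ℝ)) (fun _ => 0) (fun _ => 0) :=
      ⟨fun t => hasDerivAt_const t 0, fun t => hasDerivAt_const t 0, fun x y => by simp,
        ⟨0, fun x => by simp⟩, ⟨0, fun x => by simp⟩, ⟨0, fun x => by simp⟩⟩
    exact (abs_nonneg _).trans (h0.abs_integral_standardization_sub_le m)
  exact hle.trans_lt ((ENNReal.ofReal_lt_ofReal_iff (hB0.trans_lt hlt)).2 hlt)

/-! ### Admissible approximations of `|x|³/6` and the lower bound -/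

section EvenExtension

variable {G G' G'' : ℝ → ℝ}

/-- The derivative of the even function `x ↦ G |x|`. -/
noncomputable def oddExtension (G' : ℝ → ℝ) (x : ℝ) : ℝ := if 0 ≤ x then G' x else -G' (-x)

lemma continuous_oddExtension (h : Continuous G') (h0 : G' 0 = 0) :
    Continuous (oddExtension G') :=
  Continuous.if_le h (by fun_prop) continuous_const continuous_id fun x hx => by
    rw [← show (0 : ℝ) = x from hx, neg_zero, h0, neg_zero]

lemma hasDerivAt_comp_abs (h : ∀ t, HasDerivAt G (G' t) t) (hc : Continuous G') (h0 : G' 0 = 0)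
    (t : ℝ) : HasDerivAt (fun x => G |x|) (oddExtension G' t) t := by
  have hG : Continuous G := continuous_iff_continuousAt.2 fun t => (h t).continuousAt
  refine hasDerivAt_of_hasDerivAt_of_ne' (f := fun x => G |x|) (g := oddExtension G') (x := 0)
    (fun y hy => ?_) (by fun_prop) (continuous_oddExtension hc h0).continuousAt t
  rcases lt_or_gt_of_ne hy with hy | hy
  · rw [oddExtension, if_neg (not_le.2 hy)]
    have : HasDerivAt (fun x => G (-x)) (-G' (-y)) y :=
      ((h (-y)).comp y (hasDerivAt_neg y)).congr_deriv (by ring)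
    refine this.congr_of_eventuallyEq ?_
    filter_upwards [eventually_lt_nhds hy] with x hx
    rw [abs_of_neg hx]
  · rw [oddExtension, if_pos hy.le]
    refine (h y).congr_of_eventuallyEq ?_
    filter_upwards [eventually_gt_nhds hy] with x hx
    rw [abs_of_pos hx]

lemma hasDerivAt_oddExtension (h : ∀ t, HasDerivAt G' (G'' t) t) (hc : Continuous G'')
    (h0 : G' 0 = 0) (t : ℝ) : HasDerivAt (oddExtension G') (G'' |t|) t := by
  have hG : Continuous G' := continuous_iff_continuousAt.2 fun t => (h t).continuousAt
  refine hasDerivAt_of_hasDerivAt_of_ne' (f := oddExtension G') (g := fun x => G'' |x|) (x := 0)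
    (fun y hy => ?_) (continuous_oddExtension hG h0).continuousAt (by fun_prop) t
  rcases lt_or_gt_of_ne hy with hy | hy
  · rw [abs_of_neg hy]
    have : HasDerivAt (fun x => -G' (-x)) (G'' (-y)) y :=
      ((h (-y)).comp y (hasDerivAt_neg y)).neg.congr_deriv (by ring)
    refine this.congr_of_eventuallyEq ?_
    filter_upwards [eventually_lt_nhds hy] with x hx
    rw [oddExtension, if_neg (not_le.2 hx)]
  · rw [abs_of_pos hy]
    refine (h y).congr_of_eventuallyEq ?_
    filter_upwards [eventually_gt_nhds hy] with x hx
    rw [oddExtension, if_pos hx.le]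

end EvenExtension

lemma hasDerivAt_exp_neg (t : ℝ) : HasDerivAt (fun x => Real.exp (-x)) (-Real.exp (-t)) t :=
  (hasDerivAt_neg t).exp.congr_deriv (by ring)

/-- A bounded test function that behaves like `|x|³/6` near `0`. -/
lemma isLipschitzTest_saturated_cube :
    IsLipschitzTest (fun x => (1 - Real.exp (-|x|)) ^ 3 / 6)
      (oddExtension fun x => (1 - Real.exp (-x)) ^ 2 * Real.exp (-x) / 2)
      (fun x => Real.exp (-|x|) * (1 - Real.exp (-|x|)) * (3 * Real.exp (-|x|) - 1) / 2) := by
  have hu := fun x : ℝ => (hasDerivAt_exp_neg x).const_sub 1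
  have hu1 : ∀ x : ℝ, 0 ≤ x → Real.exp (-x) ≤ 1 := fun x hx => Real.exp_le_one_iff.2 (by linarith)
  have h1 : ∀ t : ℝ, HasDerivAt (fun x => (1 - Real.exp (-x)) ^ 3 / 6)
      ((1 - Real.exp (-t)) ^ 2 * Real.exp (-t) / 2) t := fun t =>
    (((hu t).pow 3).div_const 6).congr_deriv (by norm_num; ring)
  have h2 : ∀ t : ℝ, HasDerivAt (fun x => (1 - Real.exp (-x)) ^ 2 * Real.exp (-x) / 2)
      (Real.exp (-t) * (1 - Real.exp (-t)) * (3 * Real.exp (-t) - 1) / 2) t := fun t =>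
    ((((hu t).pow 2).mul (hasDerivAt_exp_neg t)).div_const 2).congr_deriv (by norm_num; ring)
  have h3 : ∀ t : ℝ, HasDerivAt
      (fun x => Real.exp (-x) * (1 - Real.exp (-x)) * (3 * Real.exp (-x) - 1) / 2)
      (Real.exp (-t) * (1 - 8 * Real.exp (-t) + 9 * Real.exp (-t) ^ 2) / 2) t := fun t =>
    ((((hasDerivAt_exp_neg t).mul (hu t)).mul
      (((hasDerivAt_exp_neg t).const_mul 3).sub_const 1)).div_const 2).congr_deriv (by
        simp only [Pi.mul_apply]; ring)
  refine ⟨hasDerivAt_comp_abs h1 (by fun_prop) (by simp),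
    hasDerivAt_oddExtension h2 (by fun_prop) (by simp), fun x y => ?_, ⟨1, fun x => ?_⟩,
    ⟨1, fun x => ?_⟩, ⟨1, fun x => ?_⟩⟩
  · have := (convex_Ici (0 : ℝ)).norm_image_sub_le_of_norm_hasDerivWithin_le (C := 1)
      (fun t _ => (h3 t).hasDerivWithinAt) (fun t ht => by
        have h0 := Real.exp_pos (-t)
        have h1 := hu1 t ht
        rw [Real.norm_eq_abs, abs_le]
        generalize Real.exp (-t) = u at *
        -- With `u = exp (-t)`, the lower bound follows from `9 * (1 - 8u + 9u²) = (9u - 4)² - 7`.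
        -- The upper bound is attained at `u = 1`, where the function behaves like `t³/6`.
        constructor
        · nlinarith [mul_nonneg h0.le (sq_nonneg (9 * u - 4))]
        · nlinarith [mul_nonneg h0.le (sub_nonneg.2 h1),
            mul_nonneg (mul_nonneg h0.le h0.le) (sub_nonneg.2 h1)])
      (Set.mem_Ici.2 (abs_nonneg y)) (Set.mem_Ici.2 (abs_nonneg x))
    rw [one_mul] at this
    exact this.trans (abs_abs_sub_abs_le x y)
  · have h0 := Real.exp_pos (-|x|)
    have h1 := hu1 |x| (abs_nonneg x)
    have h2 : (1 - Real.exp (-|x|)) ^ 3 ≤ 1 := pow_le_one₀ (by linarith) (by linarith)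
    have h3 : 0 ≤ (1 - Real.exp (-|x|)) ^ 3 := pow_nonneg (by linarith) _
    rw [abs_le]; constructor <;> linarith
  · have key : ∀ t : ℝ, 0 ≤ t → |(1 - Real.exp (-t)) ^ 2 * Real.exp (-t) / 2| ≤ 1 := by
      intro t ht
      have h0 := Real.exp_pos (-t)
      have h1 := hu1 t ht
      have h2 : (1 - Real.exp (-t)) ^ 2 ≤ 1 := pow_le_one₀ (by linarith) (by linarith)
      rw [abs_of_nonneg (by positivity)]
      nlinarith
    unfold oddExtension
    split_ifs with hx
    · exact key x hx
    · rw [abs_neg]; exact key (-x) (by linarith)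
  · have h0 := Real.exp_pos (-|x|)
    have h1 := hu1 |x| (abs_nonneg x)
    generalize Real.exp (-|x|) = u at *
    rw [abs_div, abs_mul, abs_mul, abs_of_pos h0, abs_of_nonneg (by linarith : 0 ≤ 1 - u),
      abs_two, div_le_iff₀ two_pos, one_mul]
    have h2 : |3 * u - 1| ≤ 2 := by rw [abs_le]; constructor <;> linarith
    have h3 : u * (1 - u) ≤ 1 := by nlinarith
    have h4 : 0 ≤ u * (1 - u) := mul_nonneg h0.le (by linarith)
    nlinarith [abs_nonneg (3 * u - 1)]

lemma tendsto_mul_one_sub_exp {t : ℝ} (ht : 0 ≤ t) :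
    Tendsto (fun m : ℕ => ((m : ℝ) + 1) * (1 - Real.exp (-(t / (m + 1))))) atTop (nhds t) := by
  have hdiv : Tendsto (fun m : ℕ => t / ((m : ℝ) + 1)) atTop (nhds 0) :=
    (tendsto_atTop_add_const_right _ _ tendsto_natCast_atTop_atTop).const_div_atTop t
  have hlow : Tendsto (fun m : ℕ => t / (1 + t / ((m : ℝ) + 1))) atTop (nhds t) := by
    have := (tendsto_const_nhds (x := t)).div (hdiv.const_add 1) (by norm_num)
    rwa [add_zero, div_one] at this
  refine tendsto_of_tendsto_of_tendsto_of_le_of_le hlow tendsto_const_nhds (fun m => ?_) fun m => ?_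
  · have hm : (0 : ℝ) < m + 1 := by positivity
    have h1 : Real.exp (-(t / (m + 1))) ≤ 1 / (1 + t / (m + 1)) := by
      rw [Real.exp_neg, ← one_div]
      apply one_div_le_one_div_of_le (by positivity)
      linarith [Real.add_one_le_exp (t / ((m : ℝ) + 1))]
    calc t / (1 + t / ((m : ℝ) + 1)) = (m + 1) * (1 - 1 / (1 + t / (m + 1))) := by
          field_simp; ring
      _ ≤ _ := by gcongr
  · have hm : (0 : ℝ) < m + 1 := by positivity
    calc ((m : ℝ) + 1) * (1 - Real.exp (-(t / (m + 1)))) ≤ (m + 1) * (t / (m + 1)) := by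
          gcongr
          linarith [Real.add_one_le_exp (-(t / ((m : ℝ) + 1)))]
      _ = t := by field_simp

/-- The saturated cube at scale `m + 1`. -/
noncomputable def saturatedCube (m : ℕ) (x : ℝ) : ℝ :=
  ((m : ℝ) + 1) ^ 3 * ((1 - Real.exp (-|x / (m + 1)|)) ^ 3 / 6)

lemma saturatedCube_eq (m : ℕ) (x : ℝ) :
    saturatedCube m x = (((m : ℝ) + 1) * (1 - Real.exp (-(|x| / (m + 1))))) ^ 3 / 6 := by
  rw [saturatedCube, abs_div, abs_of_pos (by positivity : (0 : ℝ) < m + 1), mul_pow]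
  ring

/-- Dominated convergence applies with the limit itself as majorant, because `1 - exp (-y) ≤ y`. -/
lemma tendsto_integral_saturatedCube (μ : Measure ℝ)
    (hμ : Integrable (fun x => |x| ^ 3 / 6) μ) :
    Tendsto (fun m => ∫ x, saturatedCube m x ∂μ) atTop (nhds (∫ x, |x| ^ 3 / 6 ∂μ)) := by
  refine tendsto_integral_of_dominated_convergence (fun x => |x| ^ 3 / 6) (fun m => ?_) hμ
    (fun m => ae_of_all _ fun x => ?_) (ae_of_all _ fun x => ?_)
  · unfold saturatedCube
    exact Continuous.aestronglyMeasurable (by fun_prop)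
  · have hm : (0 : ℝ) < m + 1 := by positivity
    have h1 : Real.exp (-(|x| / ((m : ℝ) + 1))) ≤ 1 :=
      Real.exp_le_one_iff.2 (by rw [neg_nonpos]; positivity)
    have h0 : 0 ≤ ((m : ℝ) + 1) * (1 - Real.exp (-(|x| / (m + 1)))) :=
      mul_nonneg hm.le (by linarith)
    rw [saturatedCube_eq, Real.norm_eq_abs, abs_of_nonneg (by positivity)]
    gcongr
    calc ((m : ℝ) + 1) * (1 - Real.exp (-(|x| / (m + 1)))) ≤ (m + 1) * (|x| / (m + 1)) := by
          gcongr
          linarith [Real.add_one_le_exp (-(|x| / ((m : ℝ) + 1)))]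
      _ = |x| := by field_simp
  · simp_rw [saturatedCube_eq]
    exact ((tendsto_mul_one_sub_exp (abs_nonneg x)).pow 3).div_const 6

lemma integrable_standardization_symBinomial {f : ℝ → ℝ} (hf : Continuous f) (n : ℕ) :
    Integrable f (standardization (symBinomial n)) := by
  rw [standardization, integrable_map_measure hf.aestronglyMeasurable (by fun_prop), symBinomial]
  exact integrable_map_cast_binomial _

/-- Every saturated cube is admissible, so the supremum bounds its discrepancy, and the bound passes
to the limit. -/
lemma ofReal_binomialNormalLower_le {n : ℕ} (hn : 1 ≤ n) :
    ENNReal.ofReal (binomialNormalLower n) ≤ binomialNormalDist n := by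
  rw [binomialNormalLower_eq_integral hn]
  have hP := tendsto_integral_saturatedCube (standardization (symBinomial n))
    (integrable_standardization_symBinomial (by fun_prop) n)
  have hN := tendsto_integral_saturatedCube (gaussianReal 0 1)
    ((integrable_abs_pow_gaussianReal 1 3).div_const 6)
  refine le_of_tendsto' (ENNReal.tendsto_ofReal (hP.sub hN).abs) fun m => ?_
  have hmem : saturatedCube m ∈ BoundedZolotarevClass 3 :=
    (isLipschitzTest_saturated_cube.scale (by positivity : (0 : ℝ) < m + 1)).mem
  exact le_iSup₂_of_le (saturatedCube m) hmem le_rfl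

theorem theorem1p10 :
    -- the lower bound is `1 / (6 √(2π) n) + O(n⁻²)` as `n → ∞`
    ((fun n : ℕ => binomialNormalLower n - 1 / (6 * √(2 * Real.pi) * n))
      =O[atTop] fun n : ℕ => 1 / (n : ℝ) ^ 2) ∧
    -- the chain of relations for every `n ≥ 1`
    (∀ n : ℕ, 1 ≤ n →
      binomialNormalLower n
          = |∫ x, |x| ^ 3 / 6 ∂(standardization (symBinomial n))
              - ∫ x, |x| ^ 3 / 6 ∂(gaussianReal 0 1)| ∧
      ENNReal.ofReal (binomialNormalLower n) ≤ binomialNormalDist n ∧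
      binomialNormalDist n < ENNReal.ofReal (binomialNormalUpper n) ∧
      binomialNormalUpper n < 0.1330 / n + 0.0022 / (n : ℝ) ^ (3 / 2 : ℝ) ∧
      0.1330 / (n : ℝ) + 0.0022 / (n : ℝ) ^ (3 / 2 : ℝ) ≤ 0.1352 / n) ∧
    -- `ζ(1/2)` is real and equals `-1.4603…`
    ((riemannZeta (1 / 2)).im = 0 ∧
      -1.4604 < (riemannZeta (1 / 2)).re ∧ (riemannZeta (1 / 2)).re ≤ -1.4603) :=
  ⟨binomialNormalLower_isBigO,
    fun _ hn => ⟨binomialNormalLower_eq_integral hn, ofReal_binomialNormalLower_le hn,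
      binomialNormalDist_lt hn, binomialNormalUpper_lt_and_le hn⟩,
    riemannZeta_half_im, zeta_half_bounds⟩
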